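/- **Online bipartite matching with inner-product weight.** Let $x_1,\dots,x_n\in\mathbb R^d$ ($n,d\ge 1$) be offline points with $\|x_i\|_2\le D$, where $D>0$. Online points $y\in\mathbb R^d$ with $\|y\|_2\le 1$ arrive one at a time, and each has to be matched to one offline point on arrival; several online points may be matched to the same offline point. The value of a matching is $\sum_{i=1}^n\max\{0,\ \max_{y\text{ matched to }x_i}\langle x_i,y\rangle\}$ (an inner maximum over no points is omitted). At any moment let $\mathsf{alg}$ be the value of the current matching, $\mathsf{opt}$ the largest value of any matching of the online points that have arrived, and $m$ the number of these online points. There is one data structure, given by three fixed programs for a real RAM with unit-cost exact real arithmetic and fair coin tosses, and there are absolute constants $C,k\in\mathbb N$, such that for all $n,d\ge1$, $D>0$, $\varepsilon,\delta\in(0,1)$ and all such $x_1,\dots,x_n$ the following holds, where $\kappa=\max\{1,\varepsilon^{-2}D^2\}$ and $\widetilde O(f)$ stands for the bound $C f(1+\log f)^k$. * The data structure always (for all outcomes of the coins) uses at most $\widetilde O\big(\kappa\, nd\,(1+\log(n/\delta))\big)$ memory cells. * $\textsc{Init}(x_1,\dots,x_n,\varepsilon,\delta)$ always runs in time $\widetilde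 O\big(\kappa\, nd\,(1+\log(n/\delta))\big)$. * $\textsc{Update}(y)$ matches the arriving online point $y$ to an offline point. The $t$-th update always runs in time $\widetilde O\big(\kappa\,(n+d)\,(1+\log(\max\{n,t\}/\delta))\big)$; for the first $n$ online points this is $\widetilde O\big(\kappa\,(n+d)\,(1+\log(n/\delta))\big)$. * $\textsc{Query}()$ always runs in time at most $C$, that is $O(1)$, and always returns $\mathsf{alg}$. * For every adversary that chooses each request (an update with a point of norm at most $1$, or a query) depending on all earlier requests and responses, and for every number of requests, with probability at least $1-\delta$ the inequality $$\mathsf{alg}\ \ge\ \tfrac12\,\mathsf{opt}-\tfrac32\,m\,\varepsilon$$ holds after initialization and after each of the requests. -/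

import Mathlib

namespace OnlineMatching

/-! ## A randomized real RAM

A program works on natural-number registers, real registers, and arrays of natural and of real
numbers, addressed by natural-number registers. All are named by natural numbers; a program, being a
finite term, mentions finitely many registers and arrays. -/

/-- Binary operations on natural-number registers (`sub` is truncated). -/
inductive NatOp
  | add
  | sub

/-- Exact arithmetic on real registers (division by zero yields zero). -/
inductive RealOp
  | add
  | sub
  | mul
  | div

/-- The elementary instructions. There is no rounding from real to natural numbers, and no real
constants other than those computed from natural numbers. -/
inductive Instr
  /-- natural register `v` becomes the constant `c` -/
  | nconst (v c : ℕ)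
  /-- natural register `v` becomes `a op b`, for natural registers `a`, `b` -/
  | nop (op : NatOp) (v a b : ℕ)
  /-- natural register `v` becomes half of natural register `a`, rounded down -/
  | nhalf (v a : ℕ)
  /-- real register `v` becomes the value of natural register `a` -/
  | rcast (v a : ℕ)
  /-- real register `v` becomes `a op b`, for real registers `a`, `b` -/
  | rop (op : RealOp) (v a b : ℕ)
  /-- natural register `v` becomes the cell of natural array `arr` at the index in register `i` -/
  | nload (v arr i : ℕ)
  /-- the cell of natural array `arr` at the index in register `i` becomes natural register `v` -/
  | nstore (arr i v : ℕ)
  /-- real register `v` becomes the cell of real array `arr` at the index in register `i` -/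
  | rload (v arr i : ℕ)
  /-- the cell of real array `arr` at the index in register `i` becomes real register `v` -/
  | rstore (arr i v : ℕ)
  /-- natural register `v` becomes 0 or 1 by a fresh fair coin toss -/
  | coin (v : ℕ)

/-- Branching conditions: strict comparison of two natural or of two real registers. -/
inductive Test
  | nlt (a b : ℕ)
  | rlt (a b : ℕ)

/-- Programs. -/
inductive Cmd
  | skip
  | instr (i : Instr)
  | seq (c₁ c₂ : Cmd)
  | ite (t : Test) (c₁ c₂ : Cmd)
  | while (t : Test) (c : Cmd)

/-- Names of memory cells: `Sum.inl (arr, i)` is cell `i` of natural array `arr`, and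
`Sum.inr (arr, i)` is cell `i` of real array `arr`. -/
abbrev Cell := (ℕ × ℕ) ⊕ (ℕ × ℕ)

/-- Memory of the machine. `touched` is the set of all memory cells that have held an input or have
been read or written so far; it does not influence the computation and serves to measure space. -/
structure State where
  nreg : ℕ → ℕ
  rreg : ℕ → ℝ
  nmem : ℕ → ℕ → ℕ
  rmem : ℕ → ℕ → ℝ
  touched : Finset Cell

noncomputable section

def NatOp.eval : NatOp → ℕ → ℕ → ℕ
  | .add, a, b => a + b
  | .sub, a, b => a - b

def RealOp.eval : RealOp → ℝ → ℝ → ℝ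
  | .add, a, b => a + b
  | .sub, a, b => a - b
  | .mul, a, b => a * b
  | .div, a, b => a / b

def State.setN (s : State) (v a : ℕ) : State :=
  { s with nreg := Function.update s.nreg v a }

def State.setR (s : State) (v : ℕ) (a : ℝ) : State :=
  { s with rreg := Function.update s.rreg v a }

def State.touch (s : State) (c : Cell) : State :=
  { s with touched := insert c s.touched }

/-- The random effect of one instruction. -/
def Instr.run (s : State) : Instr → PMF State
  | .nconst v c => PMF.pure (s.setN v c)
  | .nop op v a b => PMF.pure (s.setN v (op.eval (s.nreg a) (s.nreg b)))
  | .nhalf v a => PMF.pure (s.setN v (s.nreg a / 2))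
  | .rcast v a => PMF.pure (s.setR v (s.nreg a : ℝ))
  | .rop op v a b => PMF.pure (s.setR v (op.eval (s.rreg a) (s.rreg b)))
  | .nload v arr i =>
      PMF.pure ((s.setN v (s.nmem arr (s.nreg i))).touch (Sum.inl (arr, s.nreg i)))
  | .nstore arr i v =>
      PMF.pure ({ s with
        nmem := Function.update s.nmem arr
          (Function.update (s.nmem arr) (s.nreg i) (s.nreg v)) }.touch (Sum.inl (arr, s.nreg i)))
  | .rload v arr i =>
      PMF.pure ((s.setR v (s.rmem arr (s.nreg i))).touch (Sum.inr (arr, s.nreg i)))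
  | .rstore arr i v =>
      PMF.pure ({ s with
        rmem := Function.update s.rmem arr
          (Function.update (s.rmem arr) (s.nreg i) (s.rreg v)) }.touch (Sum.inr (arr, s.nreg i)))
  | .coin v => (PMF.uniformOfFintype (Fin 2)).map (fun b : Fin 2 => s.setN v b.val)

def Test.Holds (s : State) : Test → Prop
  | .nlt a b => s.nreg a < s.nreg b
  | .rlt a b => s.rreg a < s.rreg b

/-- The commands still to be executed, in order, and the current memory. -/
abbrev Config := List Cmd × State

open Classical in
/-- One step of the machine, of unit cost. The machine has halted when no command is left. -/
def step : Config → PMF Config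
  | ([], s) => PMF.pure ([], s)
  | (.skip :: k, s) => PMF.pure (k, s)
  | (.instr i :: k, s) => (i.run s).map (fun s' => (k, s'))
  | (.seq c₁ c₂ :: k, s) => PMF.pure (c₁ :: c₂ :: k, s)
  | (.ite t c₁ c₂ :: k, s) => PMF.pure ((if t.Holds s then c₁ else c₂) :: k, s)
  | (.while t c :: k, s) => PMF.pure (if t.Holds s then c :: .while t c :: k else k, s)

/-- The configuration after `T` steps. -/
def steps : ℕ → Config → PMF Config
  | 0, p => PMF.pure p
  | T + 1, p => (step p).bind (steps T)

/-- Run `c` for at most `T` steps: the final memory, or `none` if `c` has not halted by then. -/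
def exec (T : ℕ) (c : Cmd) (s : State) : PMF (Option State) :=
  (steps T ([c], s)).map fun p =>
    match p with
    | ([], s') => some s'
    | (_ :: _, _) => none

/-! ## The online matching problem with inner-product weight -/

/-- Points of Euclidean space. -/
abbrev Point (d : ℕ) := EuclideanSpace ℝ (Fin d)

/-- The value of the matching `σ` of the online points `y` to the offline points `x`: each offline
point contributes the largest weight among the edges at it. An offline point all of whose edges have
negative weight contributes zero, like an offline point without edges. -/
def matchingValue {n d m : ℕ} (x : Fin n → Point d) (y : Fin m → Point d)
    (σ : Fin m → Fin n) : ℝ :=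
  ∑ u : Fin n, (Finset.univ.filter (fun v => σ v = u)).fold max 0 (fun v => inner ℝ (x u) (y v))

/-- The largest value of a matching. -/
def optValue {n d m : ℕ} (x : Fin n → Point d) (y : Fin m → Point d) : ℝ :=
  ⨆ σ : Fin m → Fin n, matchingValue x y σ

/-- What can be asked of the data structure after its initialization. -/
inductive Request (d : ℕ)
  | update (y : Point d)
  | query

/-- A request with the response of the data structure: an online point `y` was matched to the
offline point `i`, or a query was answered by `a`. -/
inductive Event (n d : ℕ)
  | matched (y : Point d) (i : Fin n)
  | answered (a : ℝ)

/-- The requests and responses so far, latest first. -/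
abbrev History (n d : ℕ) := List (Event n d)

/-- The online points that have arrived, with their partners, latest first. -/
def arrivals {n d : ℕ} (h : History n d) : List (Point d × Fin n) :=
  h.filterMap fun e =>
    match e with
    | .matched y i => some (y, i)
    | .answered _ => none

/-- The number of online points that have arrived. -/
def History.numOnline {n d : ℕ} (h : History n d) : ℕ := (arrivals h).length

/-- The value of the current matching. -/
def History.alg {n d : ℕ} (x : Fin n → Point d) (h : History n d) : ℝ :=
  matchingValue x (fun v : Fin (arrivals h).length => ((arrivals h).get v).1)
    (fun v => ((arrivals h).get v).2)

/-- The largest possible value of a matching of the online points that have arrived. -/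
def History.opt {n d : ℕ} (x : Fin n → Point d) (h : History n d) : ℝ :=
  optValue x (fun v : Fin (arrivals h).length => ((arrivals h).get v).1)

/-- An adversary chooses every request from the whole history, so adaptively. -/
abbrev Adversary (n d : ℕ) := History n d → Request d

/-! ## Data structures -/

/-- The programs of the three procedures. -/
structure DataStructure where
  init : Cmd
  update : Cmd
  query : Cmd

/-- The number of steps allowed to the initialization, to the `t`-th update (for `t = 1, 2, …`) and
to each query. -/
structure Budget where
  init : ℕ
  update : ℕ → ℕ
  query : ℕ

/-- The input of the initialization: `n`, `d` in natural registers 0, 1; `ε`, `δ` in real registers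
0, 1; the offline points in the first `n * d` cells of real array 0, row by row. Everything else is
zero. -/
def startState {n d : ℕ} (x : Fin n → Point d) (ε δ : ℝ) : State where
  nreg v := if v = 0 then n else if v = 1 then d else 0
  rreg v := if v = 0 then ε else if v = 1 then δ else 0
  nmem _ _ := 0
  rmem arr k :=
    if h : arr = 0 ∧ k < n * d then
      x (finProdFinEquiv.symm ⟨k, h.2⟩).1 (finProdFinEquiv.symm ⟨k, h.2⟩).2
    else 0
  touched := (Finset.range (n * d)).image fun k => Sum.inr (0, k)

/-- The input of an update: the arriving point is put into the first `d` cells of real array 1. -/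
def loadPoint {d : ℕ} (y : Point d) (s : State) : State :=
  { s with
    rmem := fun arr k => if h : arr = 1 ∧ k < d then y ⟨k, h.2⟩ else s.rmem arr k
    touched := s.touched ∪ (Finset.range d).image fun k => Sum.inr (1, k) }

/-- Serve one request. An update returns the index of the chosen offline point (counted from 0) in
natural register 0, and a query returns its answer in real register 0. The result is `none` if the
procedure exceeds its budget or if the index returned is not that of an offline point. -/
def serve {n d : ℕ} (P : DataStructure) (B : Budget) (A : Adversary n d)
    (s : State) (h : History n d) : PMF (Option (State × History n d)) :=
  match A h with
  | .update y =>
      (exec (B.update (h.numOnline + 1)) P.update (loadPoint y s)).map fun o =>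
        o.bind fun s' =>
          if hi : s'.nreg 0 < n then some (s', .matched y ⟨s'.nreg 0, hi⟩ :: h) else none
  | .query =>
      (exec B.query P.query s).map fun o =>
        o.map fun s' => (s', .answered (s'.rreg 0) :: h)

/-- Initialize the data structure and serve `r` requests of the adversary. -/
def session {n d : ℕ} (P : DataStructure) (B : Budget) (x : Fin n → Point d) (ε δ : ℝ)
    (A : Adversary n d) : ℕ → PMF (Option (State × History n d))
  | 0 => (exec B.init P.init (startState x ε δ)).map fun o => o.map fun s => (s, [])
  | r + 1 =>
      (session P B x ε δ A r).bind fun o =>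
        match o with
        | none => PMF.pure none
        | some (s, h) => serve P B A s h

/-- The bound `C * f * (1 + log f) ^ k` hidden by soft-O notation, for `1 ≤ f`. -/
def softO (C k : ℕ) (f : ℝ) : ℝ := C * f * (1 + Real.log f) ^ k

end

end OnlineMatching

/-!
The data structure is greedy: an arriving point `y` goes to an offline point `x i` whose gain
`⟪x i, y⟫ - w i` is largest according to estimates of the inner products, where `w i` is the value
at `x i` so far. If the estimates are accurate up to `3 / 2 * ε`, the chosen gain is smaller than
any other by at most `3 * ε`, and the value is at least half of the optimum up to `3 / 2 * ε` per
online point (`Greedy.half_opt_le`): any other matching exceeds the values `w` by at most the gains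
that the greedy choice could have had. After the choice one inner product is computed exactly, so
the values `w` and their sum, which answers the queries, carry no error.

Inner products are estimated with fresh randomness for every online point, hence an adaptive
adversary is harmless. Coordinate `j` of `y` is drawn with probability
`q j = ⌈d * y j ^ 2⌉ / 2 ^ b`, where `2 * d ≤ 2 ^ b ≤ 4 * d`; for this a table with `⌈d * y j ^ 2⌉`
copies of each `j` is built in linear time, and a place below `2 ^ b` is chosen by `b` coin tosses.
Then `x i j * y j / q j` has expectation `⟪x i, y⟫` and second moment at most `4 * ‖x i‖ ^ 2`, for
all `i` at once. The samples are scaled by `lam = ε / (8 * Q)`, where `Q` bounds `ε ^ 2` and the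
squared norms, and clipped to `[-1, 1]`. Since `exp (clip a) ≤ 1 + a + a ^ 2` (`exp_clip_le`), the
sum over `i` of the exponentials of the deviations in both directions is a supermartingale
(`average_deviation_le`), which starts at `2 * n` and is at least `(1 + lam * ε) ^ m` after `m`
samples if an estimate is off by more than `3 / 2 * ε` (`one_le_deviation`). Sampling until that
power reaches `2 * n * t * (t + 1) / δ` makes the `t`-th update fail with probability at most
`δ / (t * (t + 1))` (`triple_updateProg`), and these probabilities sum up to `δ`. The number of
samples is `O(κ * log (max n t / δ))` (`exists_rounds`), each at a cost of `O(n + d)` steps.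

Programs are verified in a Hoare logic with step counts whose triples also bound the expectation of
a potential (`Triple`). For a whole session the potential is one after a bad choice, and otherwise
`δ / (t + 1)` after `t` updates (`failurePotential`).
-/

namespace OnlineMatching

open scoped ENNReal

/-! ### Expectations -/

/-- The expectation of `f` under `p`. -/
noncomputable def expect {α : Type*} (p : PMF α) (f : α → ℝ≥0∞) : ℝ≥0∞ := ∑' a, p a * f a

theorem expect_pure {α : Type*} (a : α) (f : α → ℝ≥0∞) : expect (PMF.pure a) f = f a := by
  classical
  rw [expect, tsum_eq_single a]
  · simp
  · intro b hb
    simp [PMF.pure_apply, hb]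

theorem expect_bind {α β : Type*} (p : PMF α) (q : α → PMF β) (f : β → ℝ≥0∞) :
    expect (p.bind q) f = expect p fun a => expect (q a) f := by
  simp only [expect, PMF.bind_apply, ← ENNReal.tsum_mul_right, ← ENNReal.tsum_mul_left]
  rw [ENNReal.tsum_comm]
  simp only [mul_assoc]

theorem expect_map {α β : Type*} (p : PMF α) (g : α → β) (f : β → ℝ≥0∞) :
    expect (p.map g) f = expect p fun a => f (g a) := by
  rw [PMF.map, expect_bind]
  simp [expect_pure]

theorem expect_mono {α : Type*} {p : PMF α} {f g : α → ℝ≥0∞}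
    (h : ∀ a ∈ p.support, f a ≤ g a) : expect p f ≤ expect p g := by
  refine ENNReal.tsum_le_tsum fun a => ?_
  by_cases ha : a ∈ p.support
  · gcongr
    exact h a ha
  · rw [PMF.mem_support_iff, not_not] at ha
    simp [ha]

theorem expect_add {α : Type*} (p : PMF α) (f g : α → ℝ≥0∞) :
    expect p (fun a => f a + g a) = expect p f + expect p g := by
  simp only [expect, mul_add, ENNReal.tsum_add]

theorem expect_const {α : Type*} (p : PMF α) (v : ℝ≥0∞) : expect p (fun _ => v) = v := by
  rw [expect, ENNReal.tsum_mul_right, p.tsum_coe, one_mul]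

/-! ### A quantitative program logic -/

/-- After `N` steps from `cfg` the machine has halted in a memory satisfying `Q`, whatever the coins
show, and the expectation of `Φ` at the final memory is at most `v`. -/
def Safe (N : ℕ) (cfg : Config) (Q : State → Prop) (Φ : State → ℝ≥0∞) (v : ℝ≥0∞) : Prop :=
  (∀ p ∈ (steps N cfg).support, p.1 = [] ∧ Q p.2) ∧ expect (steps N cfg) (fun p => Φ p.2) ≤ v

/-- The quantitative Hoare triple of the logic: started in memory `s`, the command `c` always ends
within `T` steps in a memory satisfying `Q`, and there the expectation of `Φ` is at most `v`.
This is stated in continuation-passing style: if from every memory `s'` satisfying `Q` the remaining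
commands `k` end with an expectation of at most `Φ s'`, then `c` followed by `k` ends with an
expectation of at most `v`. -/
def Triple (T : ℕ) (c : Cmd) (s : State) (Q : State → Prop) (Φ : State → ℝ≥0∞) (v : ℝ≥0∞) :
    Prop :=
  ∀ (k : List Cmd) (T₂ : ℕ) (Q₂ : State → Prop) (Φ₂ : State → ℝ≥0∞),
    (∀ s', Q s' → ∀ N, T₂ ≤ N → Safe N (k, s') Q₂ Φ₂ (Φ s')) →
    ∀ N, T + T₂ ≤ N → Safe N (c :: k, s) Q₂ Φ₂ v

/-- The command `c`, started in `s`, always ends within `T` steps in a memory satisfying `Q`. -/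
def Ends (T : ℕ) (c : Cmd) (s : State) (Q : State → Prop) : Prop :=
  ∀ v : ℝ≥0∞, Triple T c s Q (fun _ => v) v

theorem Safe.mono {N : ℕ} {cfg : Config} {Q : State → Prop} {Φ : State → ℝ≥0∞} {v v' : ℝ≥0∞}
    (h : Safe N cfg Q Φ v) (hv : v ≤ v') : Safe N cfg Q Φ v' :=
  ⟨h.1, h.2.trans hv⟩

theorem Triple.conseq {T T' : ℕ} {c : Cmd} {s : State} {Q Q' : State → Prop}
    {Φ Φ' : State → ℝ≥0∞} {v v' : ℝ≥0∞} (h : Triple T c s Q Φ v) (hT : T ≤ T')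
    (hQ : ∀ s', Q s' → Q' s') (hΦ : ∀ s', Q s' → Φ' s' ≤ Φ s') (hv : v ≤ v') :
    Triple T' c s Q' Φ' v' := by
  intro k T₂ Q₂ Φ₂ hk N hN
  exact (h k T₂ Q₂ Φ₂ (fun s' hs' N' hN' => (hk s' (hQ s' hs') N' hN').mono (hΦ s' hs')) N
    (by omega)).mono hv

theorem Ends.triple {T T' : ℕ} {c : Cmd} {s : State} {Q Q' : State → Prop} {Φ : State → ℝ≥0∞}
    {v : ℝ≥0∞} (h : Ends T c s Q) (hT : T ≤ T') (hQ : ∀ s', Q s' → Q' s')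
    (hΦ : ∀ s', Q s' → Φ s' ≤ v) : Triple T' c s Q' Φ v :=
  (h v).conseq hT hQ hΦ le_rfl

theorem Ends.conseq {T T' : ℕ} {c : Cmd} {s : State} {Q Q' : State → Prop}
    (h : Ends T c s Q) (hT : T ≤ T') (hQ : ∀ s', Q s' → Q' s') : Ends T' c s Q' :=
  fun v => (h v).conseq hT hQ (fun _ _ => le_rfl) le_rfl

theorem Safe.of_step {N : ℕ} {c c' : Config} {Q : State → Prop} {Φ : State → ℝ≥0∞}
    {v : ℝ≥0∞} (hc : step c = PMF.pure c') (h : Safe N c' Q Φ v) : Safe (N + 1) c Q Φ v := by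
  have : steps (N + 1) c = steps N c' := by simp [steps, hc]
  unfold Safe
  rw [this]
  exact h

theorem Triple.skip {s : State} {Q : State → Prop} {Φ : State → ℝ≥0∞} (h : Q s) :
    Triple 1 .skip s Q Φ (Φ s) := by
  intro k T₂ Q₂ Φ₂ hk N hN
  obtain ⟨N, rfl⟩ : ∃ M, N = M + 1 := ⟨N - 1, by omega⟩
  exact Safe.of_step rfl (hk s h N (by omega))

theorem Triple.seq {T₁ T₂ T : ℕ} {c₁ c₂ : Cmd} {s : State} {Q₁ Q₂ : State → Prop}
    {Φ₁ Φ₂ : State → ℝ≥0∞} {v : ℝ≥0∞} (h₁ : Triple T₁ c₁ s Q₁ Φ₁ v)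
    (h₂ : ∀ s', Q₁ s' → Triple T₂ c₂ s' Q₂ Φ₂ (Φ₁ s')) (hT : T₁ + T₂ + 1 ≤ T) :
    Triple T (.seq c₁ c₂) s Q₂ Φ₂ v := by
  intro k T₃ Q₃ Φ₃ hk N hN
  obtain ⟨N, rfl⟩ : ∃ M, N = M + 1 := ⟨N - 1, by omega⟩
  refine Safe.of_step rfl ?_
  exact h₁ (c₂ :: k) (T₂ + T₃) Q₃ Φ₃ (fun s' hs' => h₂ s' hs' k T₃ Q₃ Φ₃ hk) N (by omega)

theorem Ends.seq {T₁ T₂ T : ℕ} {c₁ c₂ : Cmd} {s : State} {Q₁ Q₂ : State → Prop}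
    (h₁ : Ends T₁ c₁ s Q₁) (h₂ : ∀ s', Q₁ s' → Ends T₂ c₂ s' Q₂) (hT : T₁ + T₂ + 1 ≤ T) :
    Ends T (.seq c₁ c₂) s Q₂ :=
  fun v => (h₁ v).seq (fun s' hs' => h₂ s' hs' v) hT

theorem Triple.ite {T T' : ℕ} {t : Test} {c₁ c₂ : Cmd} {s : State} {Q : State → Prop}
    {Φ : State → ℝ≥0∞} {v : ℝ≥0∞} (h₁ : t.Holds s → Triple T c₁ s Q Φ v)
    (h₂ : ¬ t.Holds s → Triple T c₂ s Q Φ v) (hT : T + 1 ≤ T') :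
    Triple T' (.ite t c₁ c₂) s Q Φ v := by
  intro k T₃ Q₃ Φ₃ hk N hN
  obtain ⟨N, rfl⟩ : ∃ M, N = M + 1 := ⟨N - 1, by omega⟩
  refine Safe.of_step rfl ?_
  split_ifs with ht
  · exact h₁ ht k T₃ Q₃ Φ₃ hk N (by omega)
  · exact h₂ ht k T₃ Q₃ Φ₃ hk N (by omega)

theorem Ends.ite {T T' : ℕ} {t : Test} {c₁ c₂ : Cmd} {s : State} {Q : State → Prop}
    (h₁ : t.Holds s → Ends T c₁ s Q) (h₂ : ¬ t.Holds s → Ends T c₂ s Q) (hT : T + 1 ≤ T') :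
    Ends T' (.ite t c₁ c₂) s Q :=
  fun v => Triple.ite (fun h => h₁ h v) (fun h => h₂ h v) hT

theorem Triple.while_false {t : Test} {c : Cmd} {s : State} {Q : State → Prop}
    {Φ : State → ℝ≥0∞} (ht : ¬ t.Holds s) (h : Q s) :
    Triple 1 (.while t c) s Q Φ (Φ s) := by
  intro k T₂ Q₂ Φ₂ hk N hN
  obtain ⟨N, rfl⟩ : ∃ M, N = M + 1 := ⟨N - 1, by omega⟩
  refine Safe.of_step rfl ?_
  rw [if_neg ht]
  exact hk s h N (by omega)

theorem Triple.while_true {T₁ T₂ T : ℕ} {t : Test} {c : Cmd} {s : State}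
    {Q₁ Q₂ : State → Prop} {Φ₁ Φ₂ : State → ℝ≥0∞} {v : ℝ≥0∞} (ht : t.Holds s)
    (h₁ : Triple T₁ c s Q₁ Φ₁ v)
    (h₂ : ∀ s', Q₁ s' → Triple T₂ (.while t c) s' Q₂ Φ₂ (Φ₁ s')) (hT : T₁ + T₂ + 1 ≤ T) :
    Triple T (.while t c) s Q₂ Φ₂ v := by
  intro k T₃ Q₃ Φ₃ hk N hN
  obtain ⟨N, rfl⟩ : ∃ M, N = M + 1 := ⟨N - 1, by omega⟩
  refine Safe.of_step rfl ?_
  rw [if_pos ht]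
  exact h₁ (.while t c :: k) (T₂ + T₃) Q₃ Φ₃ (fun s' hs' => h₂ s' hs' k T₃ Q₃ Φ₃ hk) N (by omega)

/-- The loop rule. The invariant `I j` and the potential `Φ j` are indexed by the number `j` of
rounds done, out of `m` rounds in total; a round may take `τ j` steps. -/
theorem Triple.while {t : Test} {c : Cmd} (m : ℕ) (I : ℕ → State → Prop)
    (Φ : ℕ → State → ℝ≥0∞) (τ : ℕ → ℕ)
    (htest : ∀ j ≤ m, ∀ s, I j s → (t.Holds s ↔ j < m))
    (hbody : ∀ j < m, ∀ s, I j s → Triple (τ j) c s (I (j + 1)) (Φ (j + 1)) (Φ j s))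
    {s : State} (h0 : I 0 s) :
    Triple (∑ j ∈ Finset.range m, (τ j + 1) + 1) (.while t c) s (I m) (Φ m) (Φ 0 s) := by
  have key : ∀ r j, j + r = m → ∀ s, I j s →
      Triple (∑ i ∈ Finset.Ico j m, (τ i + 1) + 1) (.while t c) s (I m) (Φ m) (Φ j s) := by
    intro r
    induction r with
    | zero =>
      rintro j rfl s hs
      have := Triple.while_false (c := c) (Φ := Φ j)
        (fun h => lt_irrefl _ ((htest j le_rfl s hs).1 h)) hs
      simpa using this
    | succ r ih =>
      rintro j hj s hs
      have hlt : j < m := by omega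
      refine Triple.while_true ((htest j hlt.le s hs).2 hlt) (hbody j hlt s hs)
        (fun s' hs' => ih (j + 1) (by omega) s' hs') ?_
      rw [Finset.sum_eq_sum_Ico_succ_bot hlt]
      omega
  have := key m 0 (by omega) s h0
  rwa [← Finset.range_eq_Ico] at this

theorem Ends.while {t : Test} {c : Cmd} (m : ℕ) (I : ℕ → State → Prop) (τ : ℕ → ℕ)
    (htest : ∀ j ≤ m, ∀ s, I j s → (t.Holds s ↔ j < m))
    (hbody : ∀ j < m, ∀ s, I j s → Ends (τ j) c s (I (j + 1)))
    {s : State} (h0 : I 0 s) :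
    Ends (∑ j ∈ Finset.range m, (τ j + 1) + 1) (.while t c) s (I m) :=
  fun v => Triple.while m I (fun _ _ => v) τ htest (fun j hj s hs => hbody j hj s hs v) h0

/-! ### Effects of instructions -/

/-- Store `a` in cell `i` of natural array `arr`. -/
def State.storeN (s : State) (arr i a : ℕ) : State :=
  { s with nmem := Function.update s.nmem arr (Function.update (s.nmem arr) i a) }

/-- Store `a` in cell `i` of real array `arr`. -/
noncomputable def State.storeR (s : State) (arr i : ℕ) (a : ℝ) : State :=
  { s with rmem := Function.update s.rmem arr (Function.update (s.rmem arr) i a) }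

section Projections

variable (s : State) (v w arr arr' i : ℕ) (a : ℕ) (r : ℝ) (c : Cell)

@[simp] theorem setN_nreg : (s.setN v a).nreg w = if w = v then a else s.nreg w :=
  Function.update_apply _ _ _ _
@[simp] theorem setN_rreg : (s.setN v a).rreg = s.rreg := rfl
@[simp] theorem setN_nmem : (s.setN v a).nmem = s.nmem := rfl
@[simp] theorem setN_rmem : (s.setN v a).rmem = s.rmem := rfl
@[simp] theorem setN_touched : (s.setN v a).touched = s.touched := rfl
@[simp] theorem setR_nreg : (s.setR v r).nreg = s.nreg := rfl
@[simp] theorem setR_rreg : (s.setR v r).rreg w = if w = v then r else s.rreg w :=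
  Function.update_apply _ _ _ _
@[simp] theorem setR_nmem : (s.setR v r).nmem = s.nmem := rfl
@[simp] theorem setR_rmem : (s.setR v r).rmem = s.rmem := rfl
@[simp] theorem touch_nreg : (s.touch c).nreg = s.nreg := rfl
@[simp] theorem touch_rreg : (s.touch c).rreg = s.rreg := rfl
@[simp] theorem touch_nmem : (s.touch c).nmem = s.nmem := rfl
@[simp] theorem touch_rmem : (s.touch c).rmem = s.rmem := rfl
@[simp] theorem touch_touched : (s.touch c).touched = insert c s.touched := rfl
@[simp] theorem storeN_nreg : (s.storeN arr i a).nreg = s.nreg := rfl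
@[simp] theorem storeN_rreg : (s.storeN arr i a).rreg = s.rreg := rfl
@[simp] theorem storeN_nmem : (s.storeN arr i a).nmem arr' =
    if arr' = arr then Function.update (s.nmem arr) i a else s.nmem arr' := by
  by_cases h : arr' = arr
  · subst h; simp [State.storeN]
  · simp [State.storeN, h]
@[simp] theorem storeN_rmem : (s.storeN arr i a).rmem = s.rmem := rfl
@[simp] theorem storeR_nreg : (s.storeR arr i r).nreg = s.nreg := rfl
@[simp] theorem storeR_rreg : (s.storeR arr i r).rreg = s.rreg := rfl
@[simp] theorem storeR_nmem : (s.storeR arr i r).nmem = s.nmem := rfl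
@[simp] theorem storeR_rmem : (s.storeR arr i r).rmem arr' =
    if arr' = arr then Function.update (s.rmem arr) i r else s.rmem arr' := by
  by_cases h : arr' = arr
  · subst h; simp [State.storeR]
  · simp [State.storeR, h]

end Projections

/-- The effect of an instruction other than a coin toss. -/
noncomputable def Instr.effect (s : State) : Instr → State
  | .nconst v c => s.setN v c
  | .nop op v a b => s.setN v (op.eval (s.nreg a) (s.nreg b))
  | .nhalf v a => s.setN v (s.nreg a / 2)
  | .rcast v a => s.setR v (s.nreg a : ℝ)
  | .rop op v a b => s.setR v (op.eval (s.rreg a) (s.rreg b))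
  | .nload v arr i => (s.setN v (s.nmem arr (s.nreg i))).touch (Sum.inl (arr, s.nreg i))
  | .nstore arr i v => (s.storeN arr (s.nreg i) (s.nreg v)).touch (Sum.inl (arr, s.nreg i))
  | .rload v arr i => (s.setR v (s.rmem arr (s.nreg i))).touch (Sum.inr (arr, s.nreg i))
  | .rstore arr i v => (s.storeR arr (s.nreg i) (s.rreg v)).touch (Sum.inr (arr, s.nreg i))
  | .coin _ => s

/-- The instruction is not a coin toss. -/
def Instr.isDet : Instr → Bool
  | .coin _ => false
  | _ => true

theorem Instr.run_eq_pure {i : Instr} (h : i.isDet = true) (s : State) :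
    i.run s = PMF.pure (i.effect s) := by
  cases i <;> first | rfl | cases h

theorem Ends.instr {i : Instr} (h : i.isDet = true) (s : State) :
    Ends 1 (.instr i) s (· = i.effect s) := by
  intro v k T₂ Q₂ Φ₂ hk N hN
  obtain ⟨N, rfl⟩ : ∃ M, N = M + 1 := ⟨N - 1, by omega⟩
  refine Safe.of_step (c' := (k, i.effect s)) ?_ (hk _ rfl N (by omega))
  simp [step, Instr.run_eq_pure h, PMF.pure_map]

/-- A fair coin toss averages the potential over its two outcomes. -/
theorem Triple.coin {v : ℕ} {s : State} {Q : State → Prop} {Φ : State → ℝ≥0∞} {a b : ℝ≥0∞}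
    (h0 : Q (s.setN v 0)) (h1 : Q (s.setN v 1)) (ha : Φ (s.setN v 0) ≤ a)
    (hb : Φ (s.setN v 1) ≤ b) :
    Triple 1 (.instr (.coin v)) s Q Φ ((a + b) / 2) := by
  intro k T₂ Q₂ Φ₂ hk N hN
  obtain ⟨N, rfl⟩ : ∃ M, N = M + 1 := ⟨N - 1, by omega⟩
  have hs : steps (N + 1) (.instr (.coin v) :: k, s) =
      (PMF.uniformOfFintype (Fin 2)).bind fun b => steps N (k, s.setN v b.val) := by
    simp only [steps, step, Instr.run, PMF.map, PMF.bind_bind, PMF.pure_bind,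
      Function.comp]
  have k0 := hk _ h0 N (by omega)
  have k1 := hk _ h1 N (by omega)
  unfold Safe
  rw [hs]
  constructor
  · intro p hp
    rw [PMF.mem_support_bind_iff] at hp
    obtain ⟨c, -, hc⟩ := hp
    fin_cases c
    · exact k0.1 p hc
    · exact k1.1 p hc
  · rw [expect_bind, expect, tsum_fintype, Fin.sum_univ_two]
    simp only [PMF.uniformOfFintype_apply, Fintype.card_fin, Nat.cast_ofNat]
    rw [← mul_add, mul_comm, ← div_eq_mul_inv]
    gcongr
    · exact k0.2.trans ha
    · exact k1.2.trans hb

/-- A sequence of instructions. -/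
def Cmd.block : List Instr → Cmd
  | [] => .skip
  | i :: l => .seq (.instr i) (Cmd.block l)

theorem Ends.block (l : List Instr) (h : l.all Instr.isDet = true) (s : State) :
    Ends (2 * l.length + 1) (Cmd.block l) s (· = l.foldl Instr.effect s) := by
  induction l generalizing s with
  | nil => exact fun v => Triple.skip rfl
  | cons i l ih =>
    simp only [List.all_cons, Bool.and_eq_true] at h
    refine (Ends.instr h.1 s).seq (T₂ := 2 * l.length + 1) ?_ ?_
    · rintro s' rfl
      exact ih h.2 _
    · simp only [List.length_cons]
      omega

/-- To verify a sequence of instructions, evaluate them one after the other. -/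
theorem Ends.of_block {l : List Instr} (h : l.all Instr.isDet = true) {s : State}
    {Q : State → Prop} {T : ℕ} (hQ : Q (l.foldl Instr.effect s)) (hT : 2 * l.length + 1 ≤ T) :
    Ends T (Cmd.block l) s Q :=
  (Ends.block l h s).conseq hT (by rintro _ rfl; exact hQ)

/-! ### Counting loops -/

/-- Natural register 50 is a scratch register for constants. The loop runs `c` with natural register
`i` equal to `0, 1, …`, up to natural register `m` exclusively. -/
def Cmd.forTo (i m : ℕ) (c : Cmd) : Cmd :=
  .seq (.instr (.nconst i 0))
    (.while (.nlt i m) (.seq c (.block [.nconst 50 1, .nop .add i i 50])))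

/-- What the loop `Cmd.forTo` does between two rounds. -/
def State.next (i j : ℕ) (s : State) : State := (s.setN 50 1).setN i (j + 1)

theorem Triple.forTo {i m : ℕ} {c : Cmd} (M : ℕ) (I : ℕ → State → Prop)
    (Φ : ℕ → State → ℝ≥0∞) (τ : ℕ → ℕ) {s : State} {T : ℕ} (hi : i ≠ 50)
    (hM : ∀ j s, I j s → s.nreg m = M) (h0 : I 0 (s.setN i 0))
    (hbody : ∀ j < M, ∀ s, I j s → s.nreg i = j →
      Triple (τ j) c s (fun s' => s'.nreg i = j ∧ I (j + 1) (s'.next i j))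
        (fun s' => Φ (j + 1) (s'.next i j)) (Φ j s))
    (hT : ∑ j ∈ Finset.range M, (τ j + 7) + 3 ≤ T) :
    Triple T (.forTo i m c) s (I M) (Φ M) (Φ 0 (s.setN i 0)) := by
  refine ((Ends.instr rfl s).triple (Q' := fun s' => s' = s.setN i 0) (Φ := fun s' => Φ 0 s') le_rfl
    (by rintro _ rfl; rfl) (by rintro _ rfl; exact le_rfl)).seq
    (T₂ := ∑ j ∈ Finset.range M, (τ j + 7) + 1) (Q₁ := fun s' => s' = s.setN i 0) ?_
    (by omega)
  rintro s' rfl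
  refine (Triple.while M (fun j s => s.nreg i = j ∧ I j s) Φ (fun j => τ j + 6) ?_ ?_
    ⟨by simp, h0⟩).conseq le_rfl (fun _ h => h.2) (fun _ _ => le_rfl) le_rfl
  · rintro j - s ⟨hs, hI⟩
    simp [Test.Holds, hs, hM j s hI]
  · rintro j hj s ⟨hs, hI⟩
    refine (hbody j hj s hI hs).seq (T₂ := 5) ?_ (by omega)
    rintro s' ⟨hs', hI'⟩
    have e : [Instr.nconst 50 1, .nop .add i i 50].foldl Instr.effect s' = s'.next i j := by
      simp [Instr.effect, State.next, NatOp.eval, hs', hi]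
    refine (Ends.block [.nconst 50 1, .nop .add i i 50] rfl s').triple (by simp) ?_ ?_
    · rintro s'' rfl
      rw [e]
      exact ⟨by simp [State.next], hI'⟩
    · rintro s'' rfl
      rw [e]

theorem Ends.forTo {i m : ℕ} {c : Cmd} (M : ℕ) (I : ℕ → State → Prop) (τ : ℕ → ℕ)
    {s : State} {T : ℕ} (hi : i ≠ 50)
    (hM : ∀ j s, I j s → s.nreg m = M) (h0 : I 0 (s.setN i 0))
    (hbody : ∀ j < M, ∀ s, I j s → s.nreg i = j →
      Ends (τ j) c s (fun s' => s'.nreg i = j ∧ I (j + 1) (s'.next i j)))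
    (hT : ∑ j ∈ Finset.range M, (τ j + 7) + 3 ≤ T) :
    Ends T (.forTo i m c) s (I M) :=
  fun v => Triple.forTo M I (fun _ _ => v) τ hi hM h0
    (fun j hj s hI hs => hbody j hj s hI hs v) hT

/-- What a triple says about `exec`. -/
theorem Triple.exec {T N : ℕ} {c : Cmd} {s : State} {Q : State → Prop} {Φ : State → ℝ≥0∞}
    {v : ℝ≥0∞} (h : Triple T c s Q Φ v) (hN : T ≤ N) :
    (∀ o ∈ (exec N c s).support, ∃ s', o = some s' ∧ Q s') ∧
      ∀ Ψ : Option State → ℝ≥0∞, (∀ s', Q s' → Ψ (some s') ≤ Φ s') →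
        expect (exec N c s) Ψ ≤ v := by
  have hs : Safe N ([c], s) Q Φ v := by
    refine h [] 0 Q Φ (fun s' hs' M _ => ?_) N (by omega)
    have : steps M ([], s') = PMF.pure ([], s') := by
      induction M with
      | zero => rfl
      | succ M ih => simp [steps, step, ih]
    unfold Safe
    rw [this]
    exact ⟨by simpa using hs', by rw [expect_pure]⟩
  constructor
  · intro o ho
    rw [OnlineMatching.exec, PMF.mem_support_map_iff] at ho
    obtain ⟨⟨k, s'⟩, hp, rfl⟩ := ho
    obtain ⟨hk, hQ⟩ := hs.1 _ hp
    cases hk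
    exact ⟨s', rfl, hQ⟩
  · intro Ψ hΨ
    rw [OnlineMatching.exec, expect_map]
    refine le_trans (expect_mono ?_) hs.2
    rintro ⟨k, s'⟩ hp
    obtain ⟨hk, hQ⟩ := hs.1 _ hp
    cases hk
    exact hΨ s' hQ

/-! ### The programs

Between two requests natural registers 1 to 5 hold `d`, `n`, `b`, `2 ^ b` and the number of online
points, and real registers 0, 1, 2, 3, 4, 8, 9 hold the value of the matching, `δ`, `ε`,
`lam = ε / (8 * Q)`, `1 + lam * ε`, `1` and `-1`. During an update natural register 6 holds the
size of the sampling table, and real registers 5 to 7 hold the target, the power of `1 + lam * ε`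
that has to reach it, and the number of samples. Registers from 10 on are scratch.

Natural array 0 is the sampling table. Real arrays 0 to 4 hold the offline points, the online
point, the multipliers of the coordinates, the accumulated samples for the offline points, and the
values at the offline points. -/

/-- Natural register 4 becomes the least power of two that is at least natural register 10, and
natural register 3 its exponent, if they are 1 and 0 in the beginning. -/
def roundUpPow : Cmd :=
  .while (.nlt 4 10) (.block [.nop .add 4 4 4, .nconst 50 1, .nop .add 3 3 50])

/-- Real register 10 becomes the maximum of its former value and the squared norms of the offline
points. Natural register 12 runs through the addresses of all coordinates. -/
def maxSqNorm : Cmd :=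
  .forTo 11 2 (.seq (.block [.nconst 50 0, .rcast 11 50])
    (.seq (.forTo 13 1 (.block [.rload 12 0 12, .rop .mul 12 12 12, .rop .add 11 11 12,
        .nconst 50 1, .nop .add 12 12 50]))
      (.ite (.rlt 10 11) (.block [.rop .mul 10 11 8]) .skip)))

/-- The initialization: registers get their constants, `2 ^ b` and its exponent `b` are found, and
`Q` becomes the maximum of `ε ^ 2` and the squared norms of the offline points. -/
def initProg : Cmd :=
  .seq (.block [.nconst 50 1, .rcast 8 50, .nconst 50 0, .rcast 50 50, .rop .sub 9 50 8,
      .nop .add 2 0 50, .rop .mul 2 0 8, .rop .add 0 50 50, .rop .mul 10 2 2,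
      .nconst 3 0, .nconst 4 1, .nconst 5 0, .nop .add 10 1 1, .nconst 12 0])
    (.seq roundUpPow
      (.seq maxSqNorm
        (.block [.nconst 50 8, .rcast 50 50, .rop .mul 50 50 10, .rop .div 3 2 50,
          .rop .mul 4 3 2, .rop .add 4 8 4])))

/-- One step of the construction of the sampling table: coordinate `j`, in natural register 10, is
appended to the table until the number of its copies, counted in real register 14, is at least
`d * y j ^ 2`. Then its multiplier is put into real array 2. -/
def tableStep : Cmd :=
  .seq (.block [.rload 12 1 10, .rop .mul 13 12 12, .rop .mul 13 13 10, .nconst 50 0,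
      .rcast 14 50])
    (.seq (.while (.rlt 14 13) (.block [.nstore 0 6 10, .nconst 50 1, .nop .add 6 6 50,
        .rop .add 14 14 8]))
      (.block [.rop .mul 12 12 11, .rop .div 12 12 14, .rstore 2 10 12]))

/-- All estimates become zero. -/
def clearEstimates : Cmd :=
  .forTo 10 2 (.block [.nconst 50 0, .rcast 50 50, .rstore 3 10 50])

/-- Natural register 10 becomes a uniformly random number below two to the power of natural register
3. -/
def drawIndex : Cmd :=
  .seq (.block [.nconst 10 0])
    (.forTo 11 3 (.seq (.instr (.coin 12)) (.block [.nop .add 10 10 10, .nop .add 10 10 12])))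

/-- Real register 11 is clipped to the interval from `-1` to `1`. -/
def clipReg : Cmd :=
  .ite (.rlt 8 11) (.block [.rop .mul 11 8 8])
    (.ite (.rlt 11 9) (.block [.rop .mul 11 9 8]) .skip)

/-- The clipped multiple of the coordinate with its index in natural register 13 of every offline
point is added to the estimate for that point; the multiplier is in real register 10. -/
def accumulate : Cmd :=
  .forTo 11 2 (.seq (.block [.rload 11 0 13, .rop .mul 11 11 10])
    (.seq clipReg (.block [.rload 12 3 11, .rop .add 12 12 11, .rstore 3 11 12,
      .nop .add 13 13 1])))

/-- One sample: an entry of the sampling table, or nothing, is drawn and taken into account. -/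
def sampleStep : Cmd :=
  .seq drawIndex
    (.seq (.ite (.nlt 10 6) (.seq (.block [.nload 13 0 10, .rload 10 2 13]) accumulate) .skip)
      (.block [.rop .mul 6 6 4, .rop .add 7 7 8]))

/-- Natural register 10 becomes the offline point with the greatest estimated gain. -/
def selectBest : Cmd :=
  .seq (.block [.rop .mul 10 3 7, .nconst 10 0, .rload 11 3 10, .rop .div 11 11 10,
      .rload 12 4 10, .rop .sub 11 11 12, .rop .mul 13 11 8])
    (.forTo 11 2 (.seq (.block [.rload 11 3 11, .rop .div 11 11 10, .rload 12 4 11,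
        .rop .sub 11 11 12])
      (.ite (.rlt 13 11) (.block [.rop .mul 13 11 8, .nconst 50 0, .nop .add 10 11 50]) .skip)))

/-- Real register 10 becomes the inner product of the chosen offline point with the online point. -/
def exactProduct : Cmd :=
  .seq (.block [.nconst 12 0, .nconst 50 0, .rcast 10 50])
    (.seq (.forTo 11 10 (.block [.nop .add 12 12 1]))
      (.forTo 11 1 (.block [.rload 11 0 12, .rload 12 1 11, .rop .mul 11 11 12,
        .rop .add 10 10 11, .nconst 50 1, .nop .add 12 12 50])))

/-- The value at the chosen offline point and the value of the matching are updated, and the choice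
is reported. -/
def commit : Cmd :=
  .seq (.block [.rload 11 4 10])
    (.seq (.ite (.rlt 11 10)
        (.block [.rstore 4 10 10, .rop .sub 11 10 11, .rop .add 0 0 11]) .skip)
      (.block [.nconst 50 0, .nop .add 0 10 50]))

/-- The beginning of an update: the number `t` of online points and the target
`2 * n * t * (t + 1) / δ` are computed, and the sampling table and the samples are empty. -/
def prepare : Cmd :=
  .block [.nconst 50 1, .rcast 6 50, .nop .add 5 5 50, .rcast 5 2, .rop .add 5 5 5, .rcast 10 5,
    .rop .mul 5 5 10, .rop .add 10 10 8, .rop .mul 5 5 10, .rop .div 5 5 1,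
    .nconst 50 0, .rcast 7 50, .nconst 6 0, .rcast 10 1, .rcast 11 4, .rop .mul 11 11 3]

/-- The service of an arriving online point. -/
def updateProg : Cmd :=
  .seq prepare
    (.seq (.forTo 10 1 tableStep)
      (.seq clearEstimates
        (.seq (.while (.rlt 6 5) sampleStep)
          (.seq selectBest (.seq exactProduct commit)))))

/-! ### Frames -/

/-- Registers below 10, which hold what is needed beyond a loop, are the same in both memories. -/
structure Keeps (s s' : State) : Prop where
  nreg : ∀ v < 10, s'.nreg v = s.nreg v
  rreg : ∀ v < 10, s'.rreg v = s.rreg v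

theorem Keeps.refl (s : State) : Keeps s s := ⟨fun _ _ => rfl, fun _ _ => rfl⟩

theorem Keeps.trans {s s' s'' : State} (h : Keeps s s') (h' : Keeps s' s'') : Keeps s s'' :=
  ⟨fun v hv => (h'.nreg v hv).trans (h.nreg v hv), fun v hv => (h'.rreg v hv).trans (h.rreg v hv)⟩

section

variable (s s' : State) (v a arr i : ℕ) (r : ℝ) (c : Cell)

@[simp] theorem keeps_setN (h : 10 ≤ v) : Keeps s (s'.setN v a) ↔ Keeps s s' := by
  constructor <;> rintro ⟨h1, h2⟩ <;> refine ⟨fun w hw => ?_, fun w hw => ?_⟩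
  · simpa [show w ≠ v by omega] using h1 w hw
  · exact h2 w hw
  · simpa [show w ≠ v by omega] using h1 w hw
  · exact h2 w hw

@[simp] theorem keeps_setR (h : 10 ≤ v) : Keeps s (s'.setR v r) ↔ Keeps s s' := by
  constructor <;> rintro ⟨h1, h2⟩ <;> refine ⟨fun w hw => ?_, fun w hw => ?_⟩
  · exact h1 w hw
  · simpa [show w ≠ v by omega] using h2 w hw
  · exact h1 w hw
  · simpa [show w ≠ v by omega] using h2 w hw

@[simp] theorem keeps_touch : Keeps s (s'.touch c) ↔ Keeps s s' :=
  ⟨fun ⟨h1, h2⟩ => ⟨h1, h2⟩, fun ⟨h1, h2⟩ => ⟨h1, h2⟩⟩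
@[simp] theorem keeps_storeR : Keeps s (s'.storeR arr i r) ↔ Keeps s s' :=
  ⟨fun ⟨h1, h2⟩ => ⟨h1, h2⟩, fun ⟨h1, h2⟩ => ⟨h1, h2⟩⟩

theorem keeps_setN_setN {s s' : State} (h : Keeps s s') :
    Keeps (s.setN v a) (s'.setN v a) := by
  refine ⟨fun w hw => ?_, fun w hw => h.rreg w hw⟩
  simp only [setN_nreg, h.nreg w hw]

theorem keeps_setR_setR {s s' : State} (h : Keeps s s') :
    Keeps (s.setR v r) (s'.setR v r) := by
  refine ⟨fun w hw => h.nreg w hw, fun w hw => ?_⟩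
  simp only [setR_rreg, h.rreg w hw]

end

/-- The cells that the data structure may use: `2 * d` for the sampling table and one for each entry
of the five real arrays. -/
def Allowed (n d : ℕ) : Cell → Prop
  | .inl (a, i) => a = 0 ∧ i < 2 * d
  | .inr (a, i) => a = 0 ∧ i < n * d ∨ (a = 1 ∨ a = 2) ∧ i < d ∨ (a = 3 ∨ a = 4) ∧ i < n

/-- Only allowed cells have been used. -/
def Within (n d : ℕ) (s : State) : Prop := ∀ c ∈ s.touched, Allowed n d c

section

variable {n d : ℕ} (s : State) (v a arr i : ℕ) (r : ℝ) (c : Cell)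

@[simp] theorem within_setN : Within n d (s.setN v a) ↔ Within n d s := Iff.rfl
@[simp] theorem within_setR : Within n d (s.setR v r) ↔ Within n d s := Iff.rfl
@[simp] theorem within_storeN : Within n d (s.storeN arr i a) ↔ Within n d s := Iff.rfl
@[simp] theorem within_storeR : Within n d (s.storeR arr i r) ↔ Within n d s := Iff.rfl
@[simp] theorem within_touch :
    Within n d (s.touch c) ↔ Allowed n d c ∧ Within n d s := by
  simp [Within]
@[simp] theorem allowed_inl : Allowed n d (.inl (a, i)) ↔ a = 0 ∧ i < 2 * d := Iff.rfl
@[simp] theorem allowed_inr : Allowed n d (.inr (a, i)) ↔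
    (a = 0 ∧ i < n * d ∨ (a = 1 ∨ a = 2) ∧ i < d ∨ (a = 3 ∨ a = 4) ∧ i < n) := Iff.rfl

end

theorem Within.card_le {n d : ℕ} {s : State} (hn : 0 < n) (hd : 0 < d) (h : Within n d s) :
    s.touched.card ≤ 7 * (n * d) := by
  let f : ℕ → ℕ → Finset Cell := fun a m => (Finset.range m).image fun i => Sum.inr (a, i)
  have hf : ∀ a m, (f a m).card ≤ m := fun a m =>
    Finset.card_image_le.trans (Finset.card_range m).le
  let t : Finset Cell := (Finset.range (2 * d)).image fun i => Sum.inl (0, i)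
  have ht : t.card ≤ 2 * d := Finset.card_image_le.trans (Finset.card_range _).le
  have hsub : s.touched ⊆ t ∪ (f 0 (n * d) ∪ (f 1 d ∪ (f 2 d ∪ (f 3 n ∪ f 4 n)))) := by
    intro c hc
    have := h c hc
    rcases c with ⟨a, i⟩ | ⟨a, i⟩
    · simp only [allowed_inl] at this
      simp [t, f, this]
    · simp only [allowed_inr] at this
      rcases this with ⟨rfl, h⟩ | ⟨rfl | rfl, h⟩ | ⟨rfl | rfl, h⟩ <;> simp [t, f, h]
  have h1 := Finset.card_le_card hsub
  have u1 := Finset.card_union_le t (f 0 (n * d) ∪ (f 1 d ∪ (f 2 d ∪ (f 3 n ∪ f 4 n))))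
  have u2 := Finset.card_union_le (f 0 (n * d)) (f 1 d ∪ (f 2 d ∪ (f 3 n ∪ f 4 n)))
  have u3 := Finset.card_union_le (f 1 d) (f 2 d ∪ (f 3 n ∪ f 4 n))
  have u4 := Finset.card_union_le (f 2 d) (f 3 n ∪ f 4 n)
  have u5 := Finset.card_union_le (f 3 n) (f 4 n)
  have e1 := hf 0 (n * d)
  have e2 := hf 1 d
  have e3 := hf 2 d
  have e4 := hf 3 n
  have e5 := hf 4 n
  have hn' : d ≤ n * d := Nat.le_mul_of_pos_left d hn
  have hd' : n ≤ n * d := Nat.le_mul_of_pos_right n hd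
  omega

/-! ### Verification of the parts -/

/-- Clipping to the interval from `-1` to `1`. -/
noncomputable def clip (a : ℝ) : ℝ := max (-1) (min a 1)

theorem ends_clipReg {s : State} (h8 : s.rreg 8 = 1) (h9 : s.rreg 9 = -1) :
    Ends 5 clipReg s (· = s.setR 11 (clip (s.rreg 11))) := by
  have self : s.rreg 11 = clip (s.rreg 11) → s = s.setR 11 (clip (s.rreg 11)) := by
    intro h
    rw [← h]
    simp [State.setR]
  refine Ends.ite (T := 4) (fun h => ?_) (fun h => Ends.ite (T := 3) (fun h' => ?_) (fun h' => ?_)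
    (by norm_num)) (by norm_num)
  · simp only [Test.Holds, h8] at h
    refine Ends.of_block rfl ?_ (by simp)
    simp [Instr.effect, RealOp.eval, h8, clip, min_eq_right h.le]
  · simp only [Test.Holds, h8, h9, not_lt] at h h'
    refine Ends.of_block rfl ?_ (by simp)
    simp [Instr.effect, RealOp.eval, h8, h9, clip, min_eq_left h, max_eq_left h'.le]
  · simp only [Test.Holds, h8, h9, not_lt] at h h'
    refine fun v => (Triple.skip (Q := (· = s)) (Φ := fun _ => v) rfl).conseq (by norm_num) ?_
      (fun _ _ => le_rfl) le_rfl
    rintro _ rfl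
    exact self (by simp [clip, min_eq_left h, max_eq_right h'])

theorem ends_accumulate {n d j : ℕ} {u : ℝ} {s : State} (hj : j < d) (h13 : s.nreg 13 = j)
    (h10 : s.rreg 10 = u) (h2 : s.nreg 2 = n) (h1 : s.nreg 1 = d) (h8 : s.rreg 8 = 1)
    (h9 : s.rreg 9 = -1) (hs : Within n d s) :
    Ends (50 * n + 3) accumulate s (fun s' => Keeps s s' ∧ Within n d s' ∧ s'.nmem = s.nmem ∧
      (∀ a, a ≠ 3 → s'.rmem a = s.rmem a) ∧
      ∀ i < n, s'.rmem 3 i = s.rmem 3 i + clip (s.rmem 0 (i * d + j) * u)) := by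
  refine (Ends.forTo n (fun m s' => Keeps s s' ∧ Within n d s' ∧ s'.nmem = s.nmem ∧
      (∀ a, a ≠ 3 → s'.rmem a = s.rmem a) ∧ s'.rreg 10 = u ∧ s'.nreg 13 = m * d + j ∧
      ∀ i, s'.rmem 3 i = if i < m then s.rmem 3 i + clip (s.rmem 0 (i * d + j) * u)
        else s.rmem 3 i) (fun _ => 43) (by norm_num) ?_ ?_ ?_ ?_).conseq le_rfl ?_
  · rintro m s' ⟨hk, -⟩
    rw [hk.nreg 2 (by norm_num), h2]
  · simp [Keeps.refl, hs, h13, h10]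
  · rintro m hm s' ⟨hk, hw, hN, hR, hu, hp, hacc⟩ hi
    have k8 : s'.rreg 8 = 1 := (hk.rreg 8 (by norm_num)).trans h8
    have k9 : s'.rreg 9 = -1 := (hk.rreg 9 (by norm_num)).trans h9
    have k1 : s'.nreg 1 = d := (hk.nreg 1 (by norm_num)).trans h1
    have hlt : m * d + j < n * d := by nlinarith
    refine (Ends.block _ rfl s').seq (fun s₁ e₁ => (ends_clipReg ?_ ?_).seq
      (fun s₂ e₂ => Ends.of_block (T := 20) rfl ?_ (by simp)) le_rfl) (by simp)
    · simp [e₁, Instr.effect, k8]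
    · simp [e₁, Instr.effect, k9]
    · subst e₂ e₁
      simp [Instr.effect, State.next, RealOp.eval, NatOp.eval, hk, hw, hN, hu, hp, hi, k1, hm, hlt]
      refine ⟨?_, by ring, ?_⟩
      · intro a ha
        simp [ha, hR a ha]
      · intro i
        rcases eq_or_ne i m with rfl | hne
        · simp [hacc, hR 0]
        · rw [Function.update_of_ne hne, hacc]
          simp [hne.le_iff_lt]
  · simp; omega
  · rintro s' ⟨hk, hw, hN, hR, -, -, hacc⟩
    exact ⟨hk, hw, hN, hR, fun i hi => by rw [hacc, if_pos hi]⟩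

theorem ends_clearEstimates {n d : ℕ} {s : State} (h2 : s.nreg 2 = n) (hs : Within n d s) :
    Ends (14 * n + 3) clearEstimates s (fun s' => Keeps s s' ∧ Within n d s' ∧ s'.nmem = s.nmem ∧
      (∀ a, a ≠ 3 → s'.rmem a = s.rmem a) ∧ ∀ i < n, s'.rmem 3 i = 0) := by
  refine (Ends.forTo n (fun m s' => Keeps s s' ∧ Within n d s' ∧ s'.nmem = s.nmem ∧
      (∀ a, a ≠ 3 → s'.rmem a = s.rmem a) ∧ ∀ i < m, s'.rmem 3 i = 0) (fun _ => 7)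
      (by norm_num) ?_ ?_ ?_ ?_).conseq le_rfl ?_
  · rintro m s' ⟨hk, -⟩
    rw [hk.nreg 2 (by norm_num), h2]
  · simp [Keeps.refl, hs]
  · rintro m hm s' ⟨hk, hw, hN, hR, hacc⟩ hi
    refine Ends.of_block rfl ?_ (by simp)
    simp [Instr.effect, State.next, hk, hw, hN, hi, hm]
    refine ⟨?_, ?_⟩
    · intro a ha
      rw [if_neg ha, hR a ha]
    · intro i him
      rcases eq_or_ne i m with rfl | hne
      · simp
      · rw [Function.update_of_ne hne, hacc i (by omega)]
  · simp; omega
  · exact fun s' h => h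

/-- The number of entries of the sampling table for coordinate `j` of the online point `Y`. -/
noncomputable def copies (d : ℕ) (Y : ℕ → ℝ) (j : ℕ) : ℕ := ⌈(d : ℝ) * Y j ^ 2⌉₊

/-- Rounding up adds at most one copy per coordinate. -/
theorem sum_copies_le {d : ℕ} {Y : ℕ → ℝ} (hY : ∑ j ∈ Finset.range d, Y j ^ 2 ≤ 1) :
    ∑ j ∈ Finset.range d, copies d Y j ≤ 2 * d := by
  have h : ∀ j ∈ Finset.range d, (copies d Y j : ℝ) ≤ d * Y j ^ 2 + 1 := fun j _ =>
    (Nat.ceil_lt_add_one (by positivity)).le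
  have h' := Finset.sum_le_sum h
  rw [Finset.sum_add_distrib, ← Finset.mul_sum] at h'
  have : (d : ℝ) * ∑ j ∈ Finset.range d, Y j ^ 2 ≤ d * 1 := by gcongr
  have h2 : (∑ j ∈ Finset.range d, (copies d Y j : ℝ)) ≤ 2 * d := by
    simp at h'
    linarith
  exact_mod_cast h2

/-- What is known when `m` coordinates and `q` copies of the next one have been put into the
sampling table. Sums over the table are sums over the coordinates with multiplicity. -/
structure TableInv (n d : ℕ) (Y : ℕ → ℝ) (a : ℝ) (s : State) (m q : ℕ) (s' : State) : Prop where
  keeps : Keeps (s.setN 6 (∑ j ∈ Finset.range m, copies d Y j + q)) s'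
  within : Within n d s'
  size : s'.rreg 10 = d
  scale : s'.rreg 11 = a
  rmem : ∀ arr, arr ≠ 2 → s'.rmem arr = s.rmem arr
  mult : ∀ j < m, s'.rmem 2 j = Y j * a / copies d Y j
  entry : ∀ i < ∑ j ∈ Finset.range m, copies d Y j + q, s'.nmem 0 i < d
  sum : ∀ F : ℕ → ℝ, ∑ i ∈ Finset.range (∑ j ∈ Finset.range m, copies d Y j + q),
    F (s'.nmem 0 i) = ∑ j ∈ Finset.range m, copies d Y j * F j + q * F m

theorem ends_tableStep {n d m : ℕ} {Y : ℕ → ℝ} {a : ℝ} {s s' : State} (h8 : s.rreg 8 = 1)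
    (h1 : s.rmem 1 = Y) (hY : ∑ j ∈ Finset.range d, Y j ^ 2 ≤ 1) (hm : m < d)
    (hI : TableInv n d Y a s m 0 s') (hi : s'.nreg 10 = m) :
    Ends (10 * copies d Y m + 21) tableStep s'
      (fun s'' => s''.nreg 10 = m ∧ TableInv n d Y a s (m + 1) 0 (s''.next 10 m)) := by
  have hle : ∑ j ∈ Finset.range m, copies d Y j + copies d Y m ≤ 2 * d := by
    refine le_trans ?_ (sum_copies_le hY)
    rw [← Finset.sum_range_succ]
    exact Finset.sum_le_sum_of_subset (Finset.range_subset_range.2 hm)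
  have hy1 : s'.rmem 1 = Y := (hI.rmem 1 (by norm_num)).trans h1
  refine (Ends.block _ rfl s').seq (T₂ := 10 * copies d Y m + 9)
    (fun s₁ e₁ => (Ends.while (copies d Y m)
    (fun q s'' => TableInv n d Y a s m q s'' ∧ s''.nreg 10 = m ∧ s''.rreg 12 = Y m ∧
      s''.rreg 13 = d * Y m ^ 2 ∧ s''.rreg 14 = q) (fun _ => 9) ?_ ?_ ?_).seq (T₂ := 7) ?_ ?_) ?_
  · rintro q hq s₂ ⟨-, -, -, h13, h14⟩
    simp only [Test.Holds, h13, h14, copies, Nat.lt_ceil]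
  · rintro q hq s₂ ⟨hI, hi, h12, h13, h14⟩
    have k6 : s₂.nreg 6 = ∑ j ∈ Finset.range m, copies d Y j + q := by
      rw [hI.keeps.nreg 6 (by norm_num)]; simp
    have k8 : s₂.rreg 8 = 1 := (hI.keeps.rreg 8 (by norm_num)).trans h8
    have hlt : ∑ j ∈ Finset.range m, copies d Y j + q < 2 * d := by omega
    refine Ends.of_block rfl ⟨⟨?_, ?_, ?_, ?_, ?_, ?_, ?_, ?_⟩, ?_⟩ (by simp)
    · have := keeps_setN_setN 6 (∑ j ∈ Finset.range m, copies d Y j + (q + 1)) hI.keeps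
      refine ⟨fun w hw => ?_, fun w hw => ?_⟩
      · have := this.nreg w hw
        simp only [setN_nreg] at this
        simp [Instr.effect, NatOp.eval, k6, show w ≠ 50 by omega]
        rcases eq_or_ne w 6 with rfl | hne
        · simp [add_assoc]
        · simpa [hne] using this
      · simpa [Instr.effect, show w ≠ 14 by omega] using this.rreg w hw
    · simp [Instr.effect, hI.within, k6, hlt]
    · simp [Instr.effect, hI.size]
    · simp [Instr.effect, hI.scale]
    · intro arr harr
      simp [Instr.effect, hI.rmem arr harr]
    · intro j hj
      simp [Instr.effect, hI.mult j hj]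
    · intro i hi'
      simp [Instr.effect, k6, hi]
      rcases eq_or_ne i (∑ j ∈ Finset.range m, copies d Y j + q) with rfl | hne
      · simp [hm]
      · rw [Function.update_of_ne hne]
        exact hI.entry i (by omega)
    · intro F
      rw [← add_assoc, Finset.sum_range_succ]
      simp [Instr.effect, k6, hi]
      rw [Finset.sum_congr rfl fun i hi' => by
        rw [Function.update_of_ne (Finset.mem_range.1 hi').ne], hI.sum F]
      ring
    · simp [Instr.effect, RealOp.eval, hi, h12, h13, h14, k8]
  · subst e₁
    have := hI.size
    refine ⟨⟨?_, ?_, ?_, ?_, ?_, ?_, ?_, ?_⟩, ?_⟩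
    · simpa [Instr.effect] using hI.keeps
    · simp [Instr.effect, hI.within, hi, hm]
    · simp [Instr.effect, hI.size]
    · simp [Instr.effect, hI.scale]
    · intro arr harr
      simp [Instr.effect, hI.rmem arr harr]
    · intro j hj
      simp [Instr.effect, hI.mult j hj]
    · simpa [Instr.effect] using hI.entry
    · simpa [Instr.effect] using hI.sum
    · simp [Instr.effect, RealOp.eval, hi, hy1, this]
      ring
  · rintro s₂ ⟨hI, hi, h12, h13, h14⟩
    refine Ends.of_block rfl ⟨by simp [Instr.effect, hi], ⟨?_, ?_, ?_, ?_, ?_, ?_, ?_, ?_⟩⟩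
      (by simp)
    · have := hI.keeps
      rw [← Finset.sum_range_succ] at this
      simpa [Instr.effect, State.next] using this
    · simp [Instr.effect, State.next, hI.within, hi, hm]
    · simp [Instr.effect, State.next, hI.size]
    · simp [Instr.effect, State.next, hI.scale]
    · intro arr harr
      simp [Instr.effect, State.next, hI.rmem arr harr, harr]
    · intro j hj
      simp [Instr.effect, State.next, RealOp.eval, hi, h12, h14, hI.scale]
      rcases eq_or_ne j m with rfl | hne
      · simp
      · rw [Function.update_of_ne hne, hI.mult j (by omega)]
    · have := hI.entry
      rw [← Finset.sum_range_succ] at this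
      simpa [Instr.effect, State.next] using this
    · have := hI.sum
      rw [← Finset.sum_range_succ] at this
      intro F
      rw [Finset.sum_range_succ (fun j => (copies d Y j : ℝ) * F j)]
      simpa [Instr.effect, State.next] using this F
  · simp; omega
  · simp; omega

/-- The construction of the sampling table. -/
theorem ends_table {n d : ℕ} {Y : ℕ → ℝ} {a : ℝ} {s : State} (h1 : s.nreg 1 = d)
    (h6 : s.nreg 6 = 0)
    (h8 : s.rreg 8 = 1) (h10 : s.rreg 10 = d) (h11 : s.rreg 11 = a)
    (hm1 : s.rmem 1 = Y) (hY : ∑ j ∈ Finset.range d, Y j ^ 2 ≤ 1) (hs : Within n d s) :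
    Ends (48 * d + 3) (.forTo 10 1 tableStep) s (TableInv n d Y a s d 0) := by
  refine (Ends.forTo d (fun m s' => TableInv n d Y a s m 0 s') (fun m => 10 * copies d Y m + 21)
    (by norm_num) ?_ ?_ ?_ ?_)
  · intro m s' hI
    rw [hI.keeps.nreg 1 (by norm_num)]
    simp [h1]
  · refine ⟨?_, ?_, ?_, ?_, ?_, ?_, ?_, ?_⟩
    · refine ⟨fun w hw => ?_, fun w hw => rfl⟩
      simp [show w ≠ 10 by omega]
      rintro rfl
      exact h6
    all_goals simp [hs, h10, h11]
  · intro m hm s' hI hi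
    exact ends_tableStep h8 hm1 hY hm hI hi
  · have := sum_copies_le hY
    rw [Finset.sum_add_distrib, Finset.sum_add_distrib, ← Finset.mul_sum]
    simp
    omega

/-- The sum of `G` over the numbers below `2 ^ r` whose leading digits form `p`, relative to their
number. -/
noncomputable def dyadicAverage (G : ℕ → ℝ≥0∞) (r p : ℕ) : ℝ≥0∞ :=
  (∑ i ∈ Finset.range (2 ^ r), G (p * 2 ^ r + i)) / 2 ^ r

theorem dyadicAverage_succ (G : ℕ → ℝ≥0∞) (r p : ℕ) :
    dyadicAverage G (r + 1) p =
      (dyadicAverage G r (p + p) + dyadicAverage G r (p + p + 1)) / 2 := by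
  unfold dyadicAverage
  rw [← ENNReal.add_div, div_eq_mul_inv, div_eq_mul_inv, div_eq_mul_inv, mul_assoc,
    pow_succ (2 : ℝ≥0∞), pow_succ (2 : ℕ), mul_two (2 ^ r : ℕ), Finset.sum_range_add,
    ENNReal.mul_inv (Or.inl (by simp)) (Or.inl (by simp))]
  congr 2
  · refine Finset.sum_congr rfl fun i _ => ?_
    congr 1
    ring
  · refine Finset.sum_congr rfl fun i _ => ?_
    congr 1
    ring

/-- `drawIndex` averages over all numbers below `2 ^ b`. -/
theorem triple_drawIndex {b : ℕ} {s : State} (h3 : s.nreg 3 = b) {Q : State → Prop}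
    {Φ : State → ℝ≥0∞} (G : ℕ → ℝ≥0∞)
    (hQ : ∀ p < 2 ^ b, ∀ s', Keeps s s' → s'.nmem = s.nmem → s'.rmem = s.rmem →
      s'.touched = s.touched → s'.nreg 10 = p → Q s' ∧ Φ s' ≤ G p) :
    Triple (16 * b + 7) drawIndex s Q Φ ((∑ p ∈ Finset.range (2 ^ b), G p) / 2 ^ b) := by
  have h0 : (∑ p ∈ Finset.range (2 ^ b), G p) / 2 ^ b = dyadicAverage G b 0 := by
    simp [dyadicAverage]
  rw [h0]
  refine ((Ends.block [.nconst 10 0] rfl s).triple (Q' := fun s' => s' = s.setN 10 0)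
    (Φ := fun s' => dyadicAverage G (b - 0) (s'.nreg 10)) (T' := 3) (by simp)
    (by rintro _ rfl; rfl) (by rintro _ rfl; simp [Instr.effect])).seq
    (T₂ := 16 * b + 3) ?_ (by omega)
  rintro _ rfl
  refine (Triple.forTo b (fun m s' => Keeps s s' ∧ s'.nmem = s.nmem ∧ s'.rmem = s.rmem ∧
    s'.touched = s.touched ∧ s'.nreg 10 < 2 ^ m)
    (fun m s' => dyadicAverage G (b - m) (s'.nreg 10)) (fun _ => 8) (by norm_num) ?_ ?_ ?_
    ?_).conseq le_rfl ?_ ?_ ?_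
  · rintro m s' ⟨hk, -⟩
    rw [hk.nreg 3 (by norm_num), h3]
  · simp [Keeps.refl]
  · rintro m hm s' ⟨hk, hN, hR, hT, hp⟩ hi
    rw [show b - m = (b - (m + 1)) + 1 by omega, dyadicAverage_succ]
    refine Triple.seq (T₁ := 1) (T₂ := 5)
      (Q₁ := fun s'' => s'' = s'.setN 12 0 ∨ s'' = s'.setN 12 1)
      (Φ₁ := fun s'' => dyadicAverage G (b - (m + 1)) (s'.nreg 10 + s'.nreg 10 + s''.nreg 12))
      (Triple.coin (Or.inl rfl) (Or.inr rfl) (by simp) (by simp)) ?_ (by norm_num)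
    rintro s'' (rfl | rfl)
    · refine (Ends.block _ rfl _).triple (by simp) ?_ ?_
      · rintro _ rfl
        simp [Instr.effect, State.next, NatOp.eval, hk, hN, hR, hT, hi]
        rw [pow_succ]
        omega
      · rintro _ rfl
        simp [Instr.effect, State.next, NatOp.eval]
    · refine (Ends.block _ rfl _).triple (by simp) ?_ ?_
      · rintro _ rfl
        simp [Instr.effect, State.next, NatOp.eval, hk, hN, hR, hT, hi]
        rw [pow_succ]
        omega
      · rintro _ rfl
        simp [Instr.effect, State.next, NatOp.eval]
  · simp; omega
  · rintro s' ⟨hk, hN, hR, hT, hp⟩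
    exact (hQ _ hp s' hk hN hR hT rfl).1
  · rintro s' ⟨hk, hN, hR, hT, hp⟩
    refine (hQ _ hp s' hk hN hR hT rfl).2.trans ?_
    simp [dyadicAverage]
  · simp

/-- What is added to the estimate for the offline point `i` if the random index is `p`. -/
noncomputable def increment (d : ℕ) (s : State) (i p : ℕ) : ℝ :=
  if p < s.nreg 6 then clip (s.rmem 0 (i * d + s.nmem 0 p) * s.rmem 2 (s.nmem 0 p)) else 0

/-- The memory `s'` results from `s` by one sample with random index `p`. -/
structure Sampled (n d p : ℕ) (s s' : State) : Prop where
  keeps : Keeps ((s.setR 6 (s.rreg 6 * s.rreg 4)).setR 7 (s.rreg 7 + 1)) s'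
  within : Within n d s'
  nmem : s'.nmem = s.nmem
  rmem : ∀ arr, arr ≠ 3 → s'.rmem arr = s.rmem arr
  est : ∀ i < n, s'.rmem 3 i = s.rmem 3 i + increment d s i p

theorem triple_sampleStep {n d b : ℕ} {s : State} (h1 : s.nreg 1 = d) (h2 : s.nreg 2 = n)
    (h3 : s.nreg 3 = b) (h6 : s.nreg 6 ≤ 2 * d) (h8 : s.rreg 8 = 1) (h9 : s.rreg 9 = -1)
    (htab : ∀ p < s.nreg 6, s.nmem 0 p < d) (hs : Within n d s) {Q : State → Prop}
    {Φ : State → ℝ≥0∞} (G : ℕ → ℝ≥0∞)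
    (hQ : ∀ p < 2 ^ b, ∀ s', Sampled n d p s s' → Q s' ∧ Φ s' ≤ G p) :
    Triple (50 * n + 16 * b + 30) sampleStep s Q Φ
      ((∑ p ∈ Finset.range (2 ^ b), G p) / 2 ^ b) := by
  refine Triple.seq (T₁ := 16 * b + 7) (T₂ := 50 * n + 22)
    (Q₁ := fun s' => ∃ p < 2 ^ b, Keeps s s' ∧ s'.nmem = s.nmem ∧ s'.rmem = s.rmem ∧
      s'.touched = s.touched ∧ s'.nreg 10 = p) (Φ₁ := fun s' => G (s'.nreg 10))
    (triple_drawIndex h3 G ?_) ?_ (by omega)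
  · rintro p hp s' hk hN hR hT rfl
    exact ⟨⟨_, hp, hk, hN, hR, hT, rfl⟩, le_rfl⟩
  rintro s' ⟨p, hp, hk, hN, hR, hT, rfl⟩
  refine Ends.triple (T := 50 * n + 22) (Q := Sampled n d (s'.nreg 10) s) ?_ le_rfl
    (fun s'' hs'' => (hQ _ hp s'' hs'').1) (fun s'' hs'' => (hQ _ hp s'' hs'').2)
  refine Ends.seq (T₁ := 50 * n + 12) (T₂ := 6) (Q₁ := fun s'' => Keeps s s'' ∧ Within n d s'' ∧
      s''.nmem = s.nmem ∧ (∀ arr, arr ≠ 3 → s''.rmem arr = s.rmem arr) ∧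
      ∀ i < n, s''.rmem 3 i = s.rmem 3 i + increment d s i (s'.nreg 10)) ?_ ?_ (by omega)
  · have k6 : s'.nreg 6 = s.nreg 6 := hk.nreg 6 (by norm_num)
    have hs' : Within n d s' := by
      unfold Within
      rw [hT]
      exact hs
    refine Ends.ite (T := 50 * n + 10) (fun h => ?_) (fun h => ?_) (by omega)
    · simp only [Test.Holds, k6] at h
      have hj := htab _ h
      refine (Ends.block _ rfl s').seq (fun s₁ e₁ => (ends_accumulate (d := d) (n := n)
        (j := s.nmem 0 (s'.nreg 10)) (u := s.rmem 2 (s.nmem 0 (s'.nreg 10)))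
        hj ?_ ?_ ?_ ?_ ?_ ?_ ?_).conseq le_rfl ?_) (by simp; omega)
      · simp [e₁, Instr.effect, hN]
      · simp [e₁, Instr.effect, hN, hR]
      · simp [e₁, Instr.effect, hk.nreg, h2]
      · simp [e₁, Instr.effect, hk.nreg, h1]
      · simp [e₁, Instr.effect, hk.rreg, h8]
      · simp [e₁, Instr.effect, hk.rreg, h9]
      · simp [e₁, Instr.effect, hN, hs', hj]
        omega
      · rintro s'' ⟨hk', hw', hN', hR', hacc⟩
        have hk1 : Keeps s s₁ := by simp [e₁, Instr.effect, hk]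
        have hR1 : s₁.rmem = s.rmem := by simp [e₁, Instr.effect, hR]
        refine ⟨hk1.trans hk', hw', ?_, ?_, ?_⟩
        · rw [hN']; simp [e₁, Instr.effect, hN]
        · intro arr harr
          rw [hR' arr harr, hR1]
        · intro i hi
          rw [hacc i hi, hR1, increment, if_pos h]
    · simp only [Test.Holds, k6] at h
      refine fun v => (Triple.skip (Q := (· = s')) (Φ := fun _ => v) rfl).conseq (by omega) ?_
        (fun _ _ => le_rfl) le_rfl
      rintro _ rfl
      refine ⟨hk, hs', hN, fun arr _ => by rw [hR], fun i hi => ?_⟩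
      rw [hR, increment, if_neg h, add_zero]
  · rintro s₁ ⟨hk, hw, hN, hR, hacc⟩
    refine Ends.of_block rfl ⟨?_, ?_, ?_, ?_, ?_⟩ (by simp)
    · have := keeps_setR_setR 7 (s.rreg 7 + 1)
        (keeps_setR_setR 6 (s.rreg 6 * s.rreg 4) hk)
      simpa [Instr.effect, RealOp.eval, hk.rreg, h8] using this
    · simp [Instr.effect, hw]
    · simp [Instr.effect, hN]
    · intro arr harr
      simp [Instr.effect, hR arr harr]
    · intro i hi
      simp [Instr.effect, hacc i hi]

/-- The sum of the exponentials of the deviations of the estimates in both directions, after `m`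
samples, relative to `target`. -/
noncomputable def deviation (n : ℕ) (α β : ℕ → ℝ) (target : ℝ) (m : ℕ) (acc : ℕ → ℝ) : ℝ :=
  (∑ i ∈ Finset.range n, (Real.exp (acc i - m * α i) + Real.exp (-acc i - m * β i))) / target

/-- In expectation one sample does not increase the deviation. -/
theorem average_deviation_le {n N m : ℕ} {α β : ℕ → ℝ} {target : ℝ} {acc : ℕ → ℝ}
    {inc : ℕ → ℕ → ℝ} (hN : 0 < N) (ht : 0 < target)
    (hα : ∀ i < n, ∑ p ∈ Finset.range N, Real.exp (inc i p) ≤ N * Real.exp (α i))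
    (hβ : ∀ i < n, ∑ p ∈ Finset.range N, Real.exp (-inc i p) ≤ N * Real.exp (β i)) :
    (∑ p ∈ Finset.range N, ENNReal.ofReal
      (deviation n α β target (m + 1) (fun i => acc i + inc i p))) / N ≤
    ENNReal.ofReal (deviation n α β target m acc) := by
  have hN' : (0 : ℝ) < N := by exact_mod_cast hN
  rw [← ENNReal.ofReal_sum_of_nonneg (fun p _ => by unfold deviation; positivity),
    ← ENNReal.ofReal_natCast N, ← ENNReal.ofReal_div_of_pos hN']
  refine ENNReal.ofReal_le_ofReal ?_
  rw [div_le_iff₀ hN']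
  unfold deviation
  rw [← Finset.sum_div, Finset.sum_comm, div_mul_eq_mul_div]
  gcongr
  rw [Finset.sum_mul]
  refine Finset.sum_le_sum fun i hi => ?_
  have hi' := Finset.mem_range.1 hi
  rw [Finset.sum_add_distrib, add_mul]
  refine add_le_add ?_ ?_
  · have : ∀ p, Real.exp (acc i + inc i p - ((m + 1 : ℕ) : ℝ) * α i) =
        Real.exp (acc i - (m + 1 : ℕ) * α i) * Real.exp (inc i p) := fun p => by
      rw [← Real.exp_add]; congr 1; ring
    simp only [this, ← Finset.mul_sum]
    refine (mul_le_mul_of_nonneg_left (hα i hi') (Real.exp_pos _).le).trans_eq ?_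
    rw [mul_left_comm, ← Real.exp_add, mul_comm]
    congr 2
    push_cast
    ring
  · have : ∀ p, Real.exp (-(acc i + inc i p) - ((m + 1 : ℕ) : ℝ) * β i) =
        Real.exp (-acc i - (m + 1 : ℕ) * β i) * Real.exp (-inc i p) := fun p => by
      rw [← Real.exp_add]; congr 1; ring
    simp only [this, ← Finset.mul_sum]
    refine (mul_le_mul_of_nonneg_left (hβ i hi') (Real.exp_pos _).le).trans_eq ?_
    rw [mul_left_comm, ← Real.exp_add, mul_comm]
    congr 2
    push_cast
    ring

theorem deviation_congr {n : ℕ} {α β : ℕ → ℝ} {target : ℝ} {m : ℕ} {acc acc' : ℕ → ℝ}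
    (h : ∀ i < n, acc i = acc' i) :
    deviation n α β target m acc = deviation n α β target m acc' := by
  unfold deviation
  congr 1
  refine Finset.sum_congr rfl fun i hi => ?_
  rw [h i (Finset.mem_range.1 hi)]

/-- The sampling loop makes `m` rounds if `g ^ m` is the first power of `g` that is at least the
target. -/
theorem triple_sampling {n d b m : ℕ} {g target : ℝ} {α β : ℕ → ℝ} {s : State}
    (h1 : s.nreg 1 = d) (h2 : s.nreg 2 = n) (h3 : s.nreg 3 = b) (h6 : s.nreg 6 ≤ 2 * d)
    (r4 : s.rreg 4 = g) (r5 : s.rreg 5 = target) (r6 : s.rreg 6 = 1) (r7 : s.rreg 7 = 0)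
    (r8 : s.rreg 8 = 1) (r9 : s.rreg 9 = -1) (htab : ∀ p < s.nreg 6, s.nmem 0 p < d)
    (hs : Within n d s) (ht : 0 < target) (hlt : ∀ j < m, g ^ j < target) (hge : target ≤ g ^ m)
    (hα : ∀ i < n, ∑ p ∈ Finset.range (2 ^ b), Real.exp (increment d s i p) ≤
      ((2 ^ b : ℕ) : ℝ) * Real.exp (α i))
    (hβ : ∀ i < n, ∑ p ∈ Finset.range (2 ^ b), Real.exp (-increment d s i p) ≤
      ((2 ^ b : ℕ) : ℝ) * Real.exp (β i)) :
    Triple (m * (50 * n + 16 * b + 31) + 1) (.while (.rlt 6 5) sampleStep) s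
      (fun s' => Keeps ((s.setR 6 (g ^ m)).setR 7 m) s' ∧ Within n d s' ∧ s'.nmem = s.nmem ∧
        ∀ arr, arr ≠ 3 → s'.rmem arr = s.rmem arr)
      (fun s' => ENNReal.ofReal (deviation n α β target m (s'.rmem 3)))
      (ENNReal.ofReal (deviation n α β target 0 (s.rmem 3))) := by
  refine (Triple.while m
    (fun j s' => Keeps ((s.setR 6 (g ^ j)).setR 7 j) s' ∧ Within n d s' ∧ s'.nmem = s.nmem ∧
      ∀ arr, arr ≠ 3 → s'.rmem arr = s.rmem arr)
    (fun j s' => ENNReal.ofReal (deviation n α β target j (s'.rmem 3)))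
    (fun _ => 50 * n + 16 * b + 30) ?_ ?_ ?_).conseq ?_ (fun _ h => h) (fun _ _ => le_rfl) le_rfl
  · rintro j hj s' ⟨hk, -⟩
    have e5 := hk.rreg 5 (by norm_num)
    have e6 := hk.rreg 6 (by norm_num)
    simp [r5] at e5 e6
    simp only [Test.Holds, e5, e6]
    refine ⟨fun h => lt_of_le_of_ne hj ?_, fun h => hlt j h⟩
    rintro rfl
    exact absurd hge h.not_ge
  · rintro j hj s' ⟨hk, hw, hN, hR⟩
    have k1 := hk.nreg 1 (by norm_num)
    have k2 := hk.nreg 2 (by norm_num)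
    have k3 := hk.nreg 3 (by norm_num)
    have k6 := hk.nreg 6 (by norm_num)
    have q4 := hk.rreg 4 (by norm_num)
    have q6 := hk.rreg 6 (by norm_num)
    have q7 := hk.rreg 7 (by norm_num)
    have q8 := hk.rreg 8 (by norm_num)
    have q9 := hk.rreg 9 (by norm_num)
    simp [h1, h2, h3, r4, r8, r9] at k1 k2 k3 k6 q4 q6 q7 q8 q9
    have hinc : ∀ i p, increment d s' i p = increment d s i p := by
      intro i p
      simp only [increment, k6, hN, hR 0 (by norm_num), hR 2 (by norm_num)]
    refine (triple_sampleStep (Q := fun s'' =>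
      Keeps ((s.setR 6 (g ^ (j + 1))).setR 7 (j + 1 : ℕ)) s'' ∧
      Within n d s'' ∧ s''.nmem = s.nmem ∧ ∀ arr, arr ≠ 3 → s''.rmem arr = s.rmem arr) k1 k2 k3
      (by rw [k6]; exact h6) q8 q9 (by rw [k6, hN]; exact htab) hw
      (fun p => ENNReal.ofReal (deviation n α β target (j + 1)
        fun i => s'.rmem 3 i + increment d s i p)) ?_).conseq le_rfl (fun _ h => h)
      (fun _ _ => le_rfl) ?_
    · intro p hp s'' hs''
      refine ⟨⟨?_, hs''.within, hs''.nmem.trans hN, fun arr harr =>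
        (hs''.rmem arr harr).trans (hR arr harr)⟩, ?_⟩
      · have := keeps_setR_setR 7 ((j + 1 : ℕ) : ℝ) (keeps_setR_setR 6 (g ^ (j + 1)) hk)
        refine Keeps.trans (s' := (s'.setR 6 (g ^ (j + 1))).setR 7 (j + 1 : ℕ)) ?_ ?_
        · refine ⟨fun w hw => ?_, fun w hw => ?_⟩
          · simpa using hk.nreg w hw
          · have := hk.rreg w hw
            simp only [setR_rreg] at this ⊢
            split_ifs at this ⊢ <;> trivial
        · have := hs''.keeps
          rw [q4, q6, q7] at this
          simpa [pow_succ] using this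
      · refine (congrArg ENNReal.ofReal (deviation_congr fun i hi => ?_)).le
        rw [hs''.est i hi, hinc]
    · have := average_deviation_le (m := j) (acc := s'.rmem 3) (pow_pos (two_pos) b) ht hα hβ
      simpa using this
  · refine ⟨⟨fun w hw => rfl, fun w hw => ?_⟩, hs, rfl, fun _ _ => rfl⟩
    rcases eq_or_ne w 7 with rfl | h7
    · simpa using r7
    rcases eq_or_ne w 6 with rfl | h6
    · simpa using r6
    simp [h6, h7]
  · simp

/-- The estimated gain at the offline point `k`. -/
noncomputable def score (s : State) (k : ℕ) : ℝ :=
  s.rmem 3 k / (s.rreg 3 * s.rreg 7) - s.rmem 4 k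

theorem ends_selectBest {n d : ℕ} {s : State} (hn : 0 < n) (h2 : s.nreg 2 = n)
    (h8 : s.rreg 8 = 1) (hs : Within n d s) :
    Ends (30 * n + 30) selectBest s (fun s' => Keeps s s' ∧ Within n d s' ∧ s'.nmem = s.nmem ∧
      s'.rmem = s.rmem ∧ s'.nreg 10 < n ∧ ∀ k < n, score s k ≤ score s (s'.nreg 10)) := by
  refine (Ends.block _ rfl s).seq (T₂ := 30 * n + 3) (fun s₁ e₁ => (Ends.forTo n
    (fun m s' => Keeps s s' ∧ Within n d s' ∧ s'.nmem = s.nmem ∧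
      s'.rmem = s.rmem ∧ s'.rreg 10 = s.rreg 3 * s.rreg 7 ∧ s'.nreg 10 < n ∧
      s'.rreg 13 = score s (s'.nreg 10) ∧
      ∀ k < m, score s k ≤ score s (s'.nreg 10)) (fun _ => 20) (by norm_num)
    ?_ ?_ ?_ ?_).conseq le_rfl ?_) (by simp; omega)
  · rintro m s' ⟨hk, -⟩
    rw [hk.nreg 2 (by norm_num), h2]
  · simp [e₁, Instr.effect, RealOp.eval, Keeps.refl, hs, hn, h8, score]
  · rintro m hm s' ⟨hk, hw, hN, hR, h10, hb, h13, hmax⟩ hi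
    have k8 : s'.rreg 8 = 1 := (hk.rreg 8 (by norm_num)).trans h8
    refine (Ends.block _ rfl s').seq (T₂ := 8) (fun s₂ e₂ => Ends.ite (T := 7) (fun h => ?_)
      (fun h => ?_) (by norm_num)) (by simp)
    · subst e₂
      simp [Test.Holds, Instr.effect, RealOp.eval, hR, hi, h10, h13] at h
      refine Ends.of_block rfl ?_ (by simp)
      simp [Instr.effect, RealOp.eval, NatOp.eval, State.next, hk, hw, hN, hR, hi, h10, k8, hm]
      refine ⟨by simp [score], fun k hk => ?_⟩
      rcases eq_or_ne k m with rfl | hne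
      · exact le_rfl
      · refine (hmax k (by omega)).trans h.le
    · subst e₂
      simp [Test.Holds, Instr.effect, RealOp.eval, hR, hi, h10, h13] at h
      refine fun v => (Triple.skip (Q := fun s'' => s'' = _) (Φ := fun _ => v) rfl).conseq
        (by norm_num) ?_ (fun _ _ => le_rfl) le_rfl
      rintro _ rfl
      simp [Instr.effect, RealOp.eval, State.next, hk, hw, hN, hR, hi, h10, h13, hb, hm]
      intro k hk
      rcases eq_or_ne k m with rfl | hne
      · simp only [score] at h ⊢
        linarith
      · exact hmax k (by omega)
  · simp; omega
  · rintro s' ⟨hk, hw, hN, hR, -, hb, -, hmax⟩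
    exact ⟨hk, hw, hN, hR, hb, hmax⟩

theorem ends_exactProduct {n d i : ℕ} {s : State} (h1 : s.nreg 1 = d) (hi : i < n)
    (h10 : s.nreg 10 = i) (hs : Within n d s) :
    Ends (10 * n + 20 * d + 20) exactProduct s (fun s' => Keeps s s' ∧ Within n d s' ∧
      s'.nmem = s.nmem ∧ s'.rmem = s.rmem ∧ s'.nreg 10 = i ∧
      s'.rreg 10 = ∑ j ∈ Finset.range d, s.rmem 0 (i * d + j) * s.rmem 1 j) := by
  refine (Ends.block _ rfl s).seq (T₂ := 10 * n + 20 * d + 10) (fun s₁ e₁ => (Ends.forTo i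
    (T := 10 * n + 3)
    (fun m s' => Keeps s s' ∧ Within n d s' ∧ s'.nmem = s.nmem ∧ s'.rmem = s.rmem ∧
      s'.nreg 10 = i ∧ s'.rreg 10 = 0 ∧ s'.nreg 12 = m * d) (fun _ => 3) (by norm_num)
    ?_ ?_ ?_ ?_).seq (T₂ := 20 * d + 3) (fun s₂ hs₂ => (Ends.forTo d
    (fun m s' => Keeps s s' ∧ Within n d s' ∧ s'.nmem = s.nmem ∧ s'.rmem = s.rmem ∧
      s'.nreg 10 = i ∧ s'.nreg 12 = i * d + m ∧
      s'.rreg 10 = ∑ j ∈ Finset.range m, s.rmem 0 (i * d + j) * s.rmem 1 j)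
    (fun _ => 13) (by norm_num) ?_ ?_ ?_ ?_).conseq le_rfl ?_) (by omega)) (by simp; omega)
  · rintro m s' ⟨-, -, -, -, h, -⟩
    exact h
  · simp [e₁, Instr.effect, Keeps.refl, hs, h10]
  · rintro m hm s' ⟨hk, hw, hN, hR, h10, hr, h12⟩ h11
    refine Ends.of_block rfl ?_ (by simp)
    have k1 : s'.nreg 1 = d := (hk.nreg 1 (by norm_num)).trans h1
    simp [Instr.effect, NatOp.eval, State.next, hk, hw, hN, hR, h10, hr, h11, h12, k1]
    ring
  · simp; omega
  · rintro m s' ⟨hk, -⟩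
    rw [hk.nreg 1 (by norm_num), h1]
  · obtain ⟨hk, hw, hN, hR, h10, hr, h12⟩ := hs₂
    simp [hk, hw, hN, hR, h10, hr, h12]
  · rintro m hm s' ⟨hk, hw, hN, hR, h10, h12, hr⟩ h11
    refine Ends.of_block rfl ?_ (by simp)
    have : i * d + m < n * d := by nlinarith
    simp [Instr.effect, NatOp.eval, RealOp.eval, State.next, hk, hw, hN, hR, h10, hr, h11, h12, hm,
      this, Finset.sum_range_succ, add_assoc]
  · simp; omega
  · rintro s' ⟨hk, hw, hN, hR, h10, h12, hr⟩
    exact ⟨hk, hw, hN, hR, h10, hr⟩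

theorem ends_commit {n d i : ℕ} {q : ℝ} {s : State} (hi : i < n) (h10 : s.nreg 10 = i)
    (hq : s.rreg 10 = q) (hs : Within n d s) :
    Ends 30 commit s (fun s' => s'.nreg 0 = i ∧ (∀ v < 10, v ≠ 0 → s'.nreg v = s.nreg v) ∧
      s'.rreg 0 = s.rreg 0 + (max (s.rmem 4 i) q - s.rmem 4 i) ∧
      (∀ v < 10, v ≠ 0 → s'.rreg v = s.rreg v) ∧ Within n d s' ∧
      s'.rmem 4 = Function.update (s.rmem 4) i (max (s.rmem 4 i) q) ∧
      ∀ arr, arr ≠ 4 → s'.rmem arr = s.rmem arr) := by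
  refine (Ends.block _ rfl s).seq (T₂ := 20) (fun s₁ e₁ => Ends.seq (T₁ := 10) (T₂ := 5)
    (Q₁ := fun s' => (∀ v < 10, s'.nreg v = s.nreg v) ∧ s'.nreg 10 = i ∧
      s'.rreg 0 = s.rreg 0 + (max (s.rmem 4 i) q - s.rmem 4 i) ∧
      (∀ v < 10, v ≠ 0 → s'.rreg v = s.rreg v) ∧ Within n d s' ∧
      s'.rmem 4 = Function.update (s.rmem 4) i (max (s.rmem 4 i) q) ∧
      ∀ arr, arr ≠ 4 → s'.rmem arr = s.rmem arr)
    (Ends.ite (T := 7) (fun h => ?_) (fun h => ?_) (by norm_num)) (fun s₂ hs₂ => ?_) (by norm_num))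
    (by simp)
  · subst e₁
    simp [Test.Holds, Instr.effect, h10, hq] at h
    refine Ends.of_block rfl ⟨?_, ?_, ?_, ?_, ?_, ?_, ?_⟩ (by simp)
    · intro v hv
      simp [Instr.effect]
    · simp [Instr.effect, h10]
    · simp [Instr.effect, RealOp.eval, h10, hq, max_eq_right h.le]
    · intro v hv h0
      simp [Instr.effect, h0, show v ≠ 11 by omega]
    · simp [Instr.effect, hs, h10, hi]
    · simp [Instr.effect, h10, hq, max_eq_right h.le]
    · intro arr harr
      simp [Instr.effect, harr]
  · subst e₁
    simp [Test.Holds, Instr.effect, h10, hq] at h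
    refine fun v => (Triple.skip (Q := fun s'' => s'' = _) (Φ := fun _ => v) rfl).conseq
        (by norm_num) ?_ (fun _ _ => le_rfl) le_rfl
    rintro _ rfl
    refine ⟨?_, ?_, ?_, ?_, ?_, ?_, ?_⟩
    · intro v hv
      simp [Instr.effect]
    · simp [Instr.effect, h10]
    · simp [Instr.effect, max_eq_left h]
    · intro v hv h0
      simp [Instr.effect, show v ≠ 11 by omega]
    · simp [Instr.effect, hs, h10, hi]
    · simp [Instr.effect, max_eq_left h]
    · intro arr harr
      simp [Instr.effect]
  · obtain ⟨hn, h10, h0, hr, hw, h4, hR⟩ := hs₂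
    refine Ends.of_block rfl ⟨?_, ?_, ?_, ?_, ?_, ?_, ?_⟩ (by simp)
    · simp [Instr.effect, NatOp.eval, h10]
    · intro v hv h0
      simp [Instr.effect, h0, show v ≠ 50 by omega, hn v hv]
    · simp [Instr.effect, h0]
    · intro v hv h0
      simp [Instr.effect, hr v hv h0]
    · simp [Instr.effect, hw]
    · simp [Instr.effect, h4]
    · intro arr harr
      simp [Instr.effect, hR arr harr]

/-! ### Concentration of the estimates -/

theorem clip_neg (a : ℝ) : clip (-a) = -clip a := by
  unfold clip
  rcases le_total a 1 with h | h <;> rcases le_total (-1) a with h' | h'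
  · rw [min_eq_left h, max_eq_right h', min_eq_left (by linarith), max_eq_right (by linarith)]
  · rw [min_eq_left h, max_eq_left h', min_eq_right (by linarith), max_eq_right (by norm_num),
      neg_neg]
  · rw [min_eq_right h, min_eq_left (show -a ≤ 1 by linarith),
      max_eq_left (show -a ≤ -1 by linarith), max_eq_right (show (-1 : ℝ) ≤ 1 by norm_num)]
  · linarith

/-- Clipping makes exponential moments depend on the first two moments only. -/
theorem exp_clip_le (a : ℝ) : Real.exp (clip a) ≤ 1 + a + a ^ 2 := by
  unfold clip
  rcases le_total a 1 with h | h
  · rw [min_eq_left h]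
    rcases le_total (-1) a with h' | h'
    · rw [max_eq_right h']
      have := abs_le.1 (Real.abs_exp_sub_one_sub_id_le (abs_le.2 ⟨h', h⟩))
      linarith [this.2]
    · rw [max_eq_left h']
      have : Real.exp (-1) ≤ 1 := Real.exp_le_one_iff.2 (by norm_num)
      nlinarith
  · rw [min_eq_right h, max_eq_right (by norm_num)]
    have := Real.exp_one_lt_d9
    nlinarith

/-- The exponential moment of one sample `lam * x j * Y j * N / copies d Y j`, clipped, where `j` is
the entry of the sampling table at a uniformly random place below `N`, or zero if there is no entry:
entries `p < P` of the sampling table contain every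
coordinate `j` exactly `copies d Y j` times. -/
theorem sum_exp_clip_le {d N P : ℕ} {lam Q : ℝ} {x Y : ℕ → ℝ} {tab : ℕ → ℕ} (hd : 0 < d)
    (hPN : P ≤ N) (hN4 : N ≤ 4 * d) (hx : ∑ j ∈ Finset.range d, x j ^ 2 ≤ Q)
    (hsum : ∀ F : ℕ → ℝ, ∑ p ∈ Finset.range P, F (tab p) =
      ∑ j ∈ Finset.range d, copies d Y j * F j) :
    ∑ p ∈ Finset.range N, Real.exp (if p < P then
        clip (x (tab p) * (Y (tab p) * (N * lam) / copies d Y (tab p))) else 0) ≤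
      N * Real.exp (lam * ∑ j ∈ Finset.range d, x j * Y j + 4 * lam ^ 2 * Q) := by
  set a : ℕ → ℝ := fun j => x j * (Y j * (N * lam) / copies d Y j) with ha
  have hc : ∀ j, (d : ℝ) * Y j ^ 2 ≤ copies d Y j := fun j => Nat.le_ceil _
  have hd' : (0 : ℝ) < d := by exact_mod_cast hd
  have hN4' : (N : ℝ) ≤ 4 * d := by exact_mod_cast hN4
  have hterm : ∀ j, copies d Y j * (a j + a j ^ 2) ≤
      N * (lam * (x j * Y j) + 4 * lam ^ 2 * x j ^ 2) := by
    intro j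
    -- A coordinate without copies vanishes, so nothing is missed by never drawing it.
    rcases Nat.eq_zero_or_pos (copies d Y j) with h0 | hpos
    · have hY : Y j = 0 := by
        have := hc j
        rw [h0, Nat.cast_zero] at this
        have h2 : Y j ^ 2 ≤ 0 := by
          by_contra hcon
          push Not at hcon
          have := mul_pos hd' hcon
          linarith
        exact pow_eq_zero_iff (two_ne_zero) |>.1 (le_antisymm h2 (sq_nonneg _))
      rw [h0, hY]
      simp
      positivity
    · have hpos' : (0 : ℝ) < copies d Y j := by exact_mod_cast hpos
      have e1 : copies d Y j * (a j + a j ^ 2) =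
          N * (lam * (x j * Y j)) + N * lam ^ 2 * x j ^ 2 * (N * Y j ^ 2 / copies d Y j) := by
        simp only [ha]
        field_simp
      have e2 : N * Y j ^ 2 / copies d Y j ≤ 4 := by
        rw [div_le_iff₀ hpos']
        nlinarith [hc j, sq_nonneg (Y j)]
      rw [e1]
      have e3 : N * lam ^ 2 * x j ^ 2 * (N * Y j ^ 2 / copies d Y j) ≤
        N * lam ^ 2 * x j ^ 2 * 4 := mul_le_mul_of_nonneg_left e2 (by positivity)
      linarith
  have h1 : ∑ p ∈ Finset.range N, Real.exp (if p < P then clip (a (tab p)) else 0) ≤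
      ∑ p ∈ Finset.range N, (1 + if p < P then (a (tab p) + a (tab p) ^ 2) else 0) := by
    refine Finset.sum_le_sum fun p _ => ?_
    split_ifs
    · linarith [exp_clip_le (a (tab p))]
    · simp
  have hfil : (Finset.range N).filter (· < P) = Finset.range P := by
    ext p
    simp
    omega
  rw [Finset.sum_add_distrib, ← Finset.sum_filter, hfil, hsum fun j => a j + a j ^ 2] at h1
  refine h1.trans ?_
  have h2 := Finset.sum_le_sum fun j (_ : j ∈ Finset.range d) => hterm j
  rw [← Finset.mul_sum, Finset.sum_add_distrib, ← Finset.mul_sum, ← Finset.mul_sum] at h2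
  have h3 := Real.add_one_le_exp (lam * ∑ j ∈ Finset.range d, x j * Y j + 4 * lam ^ 2 * Q)
  have h4 : 4 * lam ^ 2 * ∑ j ∈ Finset.range d, x j ^ 2 ≤ 4 * lam ^ 2 * Q := by gcongr
  have h5 : (N : ℝ) * (lam * ∑ j ∈ Finset.range d, x j * Y j +
      4 * lam ^ 2 * ∑ j ∈ Finset.range d, x j ^ 2 + 1) ≤ N * Real.exp
      (lam * ∑ j ∈ Finset.range d, x j * Y j + 4 * lam ^ 2 * Q) := by
    gcongr
    linarith
  simp
  linarith

/-- If one of the estimates is off by more than `3 / 2 * ε`, then the deviation is at least one. -/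
theorem one_le_deviation {n m k : ℕ} {lam ε target : ℝ} {μ acc : ℕ → ℝ} (hk : k < n) (hm : 0 < m)
    (hlam : 0 < lam) (hε : 0 < ε) (ht : 0 < target) (hge : target ≤ (1 + lam * ε) ^ m)
    (hbad : 3 / 2 * ε < |acc k / (lam * m) - μ k|) :
    1 ≤ deviation n (fun i => lam * μ i + lam * ε / 2) (fun i => -(lam * μ i) + lam * ε / 2)
      target m acc := by
  have hm' : (0 : ℝ) < m := by exact_mod_cast hm
  have hpow : target ≤ Real.exp (m * (lam * ε)) := by
    refine hge.trans ?_
    rw [Real.exp_nat_mul]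
    have := Real.add_one_le_exp (lam * ε)
    gcongr
    linarith
  unfold deviation
  rw [le_div_iff₀ ht, one_mul]
  refine hpow.trans ?_
  have hsingle := Finset.single_le_sum (f := fun i =>
    Real.exp (acc i - m * (lam * μ i + lam * ε / 2)) +
      Real.exp (-acc i - m * (-(lam * μ i) + lam * ε / 2))) (fun i _ => by positivity)
    (Finset.mem_range.2 hk)
  refine le_trans ?_ hsingle
  have hpos : 0 < lam * m := by positivity
  rcases lt_abs.1 hbad with h | h
  · have h' : (3 / 2 * ε + μ k) * (lam * m) < acc k := by
      rw [← lt_div_iff₀ hpos]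
      linarith
    refine le_trans (Real.exp_le_exp.2 ?_) (le_add_of_nonneg_right (Real.exp_pos _).le)
    linarith
  · have h' : acc k < (μ k - 3 / 2 * ε) * (lam * m) := by
      rw [← div_lt_iff₀ hpos]
      linarith
    refine le_trans (Real.exp_le_exp.2 ?_) (le_add_of_nonneg_left (Real.exp_pos _).le)
    linarith

/-! ### An update -/

/-- The quantities fixed by the initialization: `2 ^ b` is the range of the random indices, `X`
lists the coordinates of the offline points, and `Q` bounds their squared norms. -/
structure Setup where
  (n d b : ℕ)
  X : ℕ → ℝ
  (ε δ Q : ℝ)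
  n_pos : 0 < n
  d_pos : 0 < d
  le_pow : 2 * d ≤ 2 ^ b
  pow_le : 2 ^ b ≤ 4 * d
  ε_pos : 0 < ε
  δ_pos : 0 < δ
  δ_lt : δ < 1
  le_Q : ε ^ 2 ≤ Q
  norm_le : ∀ i < n, ∑ j ∈ Finset.range d, X (i * d + j) ^ 2 ≤ Q

/-- The factor by which the samples are scaled before clipping. -/
noncomputable def Setup.lam (p : Setup) : ℝ := p.ε / (8 * p.Q)

/-- The sampling loop of update `t` ends when the growth factor to the power of the number of
samples is at least this number. -/
noncomputable def Setup.target (p : Setup) (t : ℕ) : ℝ := 2 * p.n * t * (t + 1) / p.δ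

/-- The inner product of the offline point `i` with `Y`. -/
noncomputable def Setup.dot (p : Setup) (Y : ℕ → ℝ) (i : ℕ) : ℝ :=
  ∑ j ∈ Finset.range p.d, p.X (i * p.d + j) * Y j

theorem Setup.Q_pos (p : Setup) : 0 < p.Q := lt_of_lt_of_le (pow_pos p.ε_pos 2) p.le_Q

theorem Setup.lam_pos (p : Setup) : 0 < p.lam := div_pos p.ε_pos (mul_pos (by norm_num) p.Q_pos)

/-- The content of the memory between two requests: `t` online points have arrived, the matching has
value `alg`, of which `w i` comes from the offline point `i`. -/
structure Mem (p : Setup) (t : ℕ) (alg : ℝ) (w : ℕ → ℝ) (s : State) : Prop where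
  n1 : s.nreg 1 = p.d
  n2 : s.nreg 2 = p.n
  n3 : s.nreg 3 = p.b
  n4 : s.nreg 4 = 2 ^ p.b
  n5 : s.nreg 5 = t
  r0 : s.rreg 0 = alg
  r1 : s.rreg 1 = p.δ
  r3 : s.rreg 3 = p.lam
  r4 : s.rreg 4 = 1 + p.lam * p.ε
  r8 : s.rreg 8 = 1
  r9 : s.rreg 9 = -1
  m0 : s.rmem 0 = p.X
  m4 : s.rmem 4 = w
  within : Within p.n p.d s

/-- With probability at least `1 - δ / ((t + 1) * (t + 2))` the update after `t` updates chooses an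
offline point with a gain that is smaller than any other by at most `3 * ε`. -/
theorem triple_updateProg {p : Setup} {t m : ℕ} {alg : ℝ} {w Y : ℕ → ℝ} {s : State}
    (hs : Mem p t alg w s) (h1 : s.rmem 1 = Y) (hY : ∑ j ∈ Finset.range p.d, Y j ^ 2 ≤ 1)
    (hlt : ∀ j < m, (1 + p.lam * p.ε) ^ j < p.target (t + 1))
    (hge : p.target (t + 1) ≤ (1 + p.lam * p.ε) ^ m) :
    Triple (150 * (p.n + p.d) * (m + 1)) updateProg s
      (fun s' => s'.nreg 0 < p.n ∧
        Mem p (t + 1) (alg + (max (w (s'.nreg 0)) (p.dot Y (s'.nreg 0)) - w (s'.nreg 0)))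
          (Function.update w (s'.nreg 0) (max (w (s'.nreg 0)) (p.dot Y (s'.nreg 0)))) s')
      (fun s' => open Classical in if ∃ k < p.n,
        p.dot Y (s'.nreg 0) - w (s'.nreg 0) + 3 * p.ε < p.dot Y k - w k then 1 else 0)
      (ENNReal.ofReal (p.δ / ((t + 1) * (t + 2)))) := by
  have hn' : (0 : ℝ) < p.n := by exact_mod_cast p.n_pos
  have hnd := p.n_pos
  have hdd := p.d_pos
  have hδ := p.δ_pos
  have hlam := p.lam_pos
  have ht1 : 1 < p.target (t + 1) := by
    unfold Setup.target
    rw [lt_div_iff₀ hδ, one_mul]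
    refine p.δ_lt.trans ?_
    have h1 : (1 : ℝ) ≤ p.n := by exact_mod_cast p.n_pos
    have h2 : (0 : ℝ) ≤ t := Nat.cast_nonneg t
    push_cast
    nlinarith [mul_nonneg (sub_nonneg.2 h1) h2, mul_nonneg (mul_nonneg (sub_nonneg.2 h1) h2) h2]
  have ht0 : 0 < p.target (t + 1) := by linarith
  have hm : 0 < m := by
    rcases Nat.eq_zero_or_pos m with rfl | h
    · simp at hge
      linarith
    · exact h
  have hb : p.b < 4 * p.d := lt_of_lt_of_le Nat.lt_two_pow_self p.pow_le
  have hT : ∃ T, m * (50 * p.n + 16 * p.b + 31) + 1 = T ∧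
      54 * p.n + 68 * p.d + T + 140 ≤ 150 * (p.n + p.d) * (m + 1) := by
    refine ⟨_, rfl, ?_⟩
    have : m * (50 * p.n + 16 * p.b + 31) ≤ m * (150 * (p.n + p.d)) :=
      Nat.mul_le_mul_left _ (by omega)
    have e : 150 * (p.n + p.d) * (m + 1) = m * (150 * (p.n + p.d)) + 150 * (p.n + p.d) := by ring
    rw [e]
    omega
  obtain ⟨T, hT1, hT2⟩ := hT
  -- The beginning, the table and the estimates are prepared deterministically.
  refine Triple.seq (T₁ := 33) (T₂ := 54 * p.n + 68 * p.d + T + 100)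
    ((Ends.block _ rfl s _).conseq (by simp) (fun _ h => h) (fun _ _ => le_rfl) le_rfl) ?_
    (by omega)
  intro s₁ e₁
  have a1 : s₁.nreg 1 = p.d := by simp [e₁, Instr.effect, hs.n1]
  have a2 : s₁.nreg 2 = p.n := by simp [e₁, Instr.effect, hs.n2]
  have a3 : s₁.nreg 3 = p.b := by simp [e₁, Instr.effect, hs.n3]
  have a4 : s₁.nreg 4 = 2 ^ p.b := by simp [e₁, Instr.effect, hs.n4]
  have a5 : s₁.nreg 5 = t + 1 := by simp [e₁, Instr.effect, NatOp.eval, hs.n5]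
  have a6 : s₁.nreg 6 = 0 := by simp [e₁, Instr.effect]
  have b0 : s₁.rreg 0 = alg := by simp [e₁, Instr.effect, hs.r0]
  have b1 : s₁.rreg 1 = p.δ := by simp [e₁, Instr.effect, hs.r1]
  have b3 : s₁.rreg 3 = p.lam := by simp [e₁, Instr.effect, hs.r3]
  have b4 : s₁.rreg 4 = 1 + p.lam * p.ε := by simp [e₁, Instr.effect, hs.r4]
  have b5 : s₁.rreg 5 = p.target (t + 1) := by
    simp [e₁, Instr.effect, RealOp.eval, NatOp.eval, hs.n2, hs.n5, hs.r8, hs.r1, Setup.target]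
    ring
  have b6 : s₁.rreg 6 = 1 := by simp [e₁, Instr.effect]
  have b7 : s₁.rreg 7 = 0 := by simp [e₁, Instr.effect]
  have b8 : s₁.rreg 8 = 1 := by simp [e₁, Instr.effect, hs.r8]
  have b9 : s₁.rreg 9 = -1 := by simp [e₁, Instr.effect, hs.r9]
  have b10 : s₁.rreg 10 = p.d := by simp [e₁, Instr.effect, hs.n1]
  have b11 : s₁.rreg 11 = (2 ^ p.b : ℕ) * p.lam := by
    simp [e₁, Instr.effect, RealOp.eval, hs.n4, hs.r3]
  have c0 : s₁.rmem 0 = p.X := by simp [e₁, Instr.effect, hs.m0]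
  have c1 : s₁.rmem 1 = Y := by simp [e₁, Instr.effect, h1]
  have c4 : s₁.rmem 4 = w := by simp [e₁, Instr.effect, hs.m4]
  have w1 : Within p.n p.d s₁ := by simp [e₁, Instr.effect, hs.within]
  refine Triple.seq (T₁ := 48 * p.d + 3) (T₂ := 54 * p.n + 20 * p.d + T + 90)
    (ends_table a1 a6 b8 b10 b11 c1 hY w1 _) ?_ (by omega)
  intro s₂ hs₂
  have hsize : ∑ j ∈ Finset.range p.d, copies p.d Y j ≤ 2 * p.d := sum_copies_le hY
  set P := ∑ j ∈ Finset.range p.d, copies p.d Y j with hP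
  have k2 := hs₂.keeps
  refine Triple.seq (T₁ := 14 * p.n + 3) (T₂ := 40 * p.n + 20 * p.d + T + 85)
    (ends_clearEstimates (n := p.n) (d := p.d) (by rw [k2.nreg 2 (by norm_num)]; simpa using a2)
      hs₂.within _) ?_ (by omega)
  rintro s₃ ⟨k3, w3, hN3, hR3, hacc⟩
  have k := k2.trans k3
  have f1 : s₃.nreg 1 = p.d := by rw [k.nreg 1 (by norm_num)]; simpa using a1
  have f2 : s₃.nreg 2 = p.n := by rw [k.nreg 2 (by norm_num)]; simpa using a2
  have f3 : s₃.nreg 3 = p.b := by rw [k.nreg 3 (by norm_num)]; simpa using a3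
  have f4 : s₃.nreg 4 = 2 ^ p.b := by rw [k.nreg 4 (by norm_num)]; simpa using a4
  have f5 : s₃.nreg 5 = t + 1 := by rw [k.nreg 5 (by norm_num)]; simpa using a5
  have f6 : s₃.nreg 6 = P := by rw [k.nreg 6 (by norm_num)]; simp [hP]
  have g0 : s₃.rreg 0 = alg := by rw [k.rreg 0 (by norm_num)]; simpa using b0
  have g1 : s₃.rreg 1 = p.δ := by rw [k.rreg 1 (by norm_num)]; simpa using b1
  have g3 : s₃.rreg 3 = p.lam := by rw [k.rreg 3 (by norm_num)]; simpa using b3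
  have g4 : s₃.rreg 4 = 1 + p.lam * p.ε := by rw [k.rreg 4 (by norm_num)]; simpa using b4
  have g5 : s₃.rreg 5 = p.target (t + 1) := by rw [k.rreg 5 (by norm_num)]; simpa using b5
  have g6 : s₃.rreg 6 = 1 := by rw [k.rreg 6 (by norm_num)]; simpa using b6
  have g7 : s₃.rreg 7 = 0 := by rw [k.rreg 7 (by norm_num)]; simpa using b7
  have g8 : s₃.rreg 8 = 1 := by rw [k.rreg 8 (by norm_num)]; simpa using b8
  have g9 : s₃.rreg 9 = -1 := by rw [k.rreg 9 (by norm_num)]; simpa using b9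
  have m0 : s₃.rmem 0 = p.X := by rw [hR3 0 (by norm_num), hs₂.rmem 0 (by norm_num), c0]
  have m1 : s₃.rmem 1 = Y := by rw [hR3 1 (by norm_num), hs₂.rmem 1 (by norm_num), c1]
  have m4 : s₃.rmem 4 = w := by rw [hR3 4 (by norm_num), hs₂.rmem 4 (by norm_num), c4]
  have htab : ∀ q < P, s₃.nmem 0 q < p.d := by
    rw [hN3]; simpa using hs₂.entry
  have hsum : ∀ F : ℕ → ℝ, ∑ q ∈ Finset.range P, F (s₃.nmem 0 q) =
      ∑ j ∈ Finset.range p.d, copies p.d Y j * F j := by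
    rw [hN3]; simpa using hs₂.sum
  have hinc : ∀ i q, increment p.d s₃ i q = if q < P then
      clip (p.X (i * p.d + s₃.nmem 0 q) * (Y (s₃.nmem 0 q) * ((2 ^ p.b : ℕ) * p.lam) /
        copies p.d Y (s₃.nmem 0 q))) else 0 := by
    intro i q
    rw [increment, f6, m0, hR3 2 (by norm_num)]
    refine if_ctx_congr Iff.rfl (fun h => ?_) fun _ => rfl
    rw [hs₂.mult _ (htab q h)]
  -- The second moments of the scaled samples are at most `4 * lam ^ 2 * Q`.
  have hvar : 4 * p.lam ^ 2 * p.Q = p.lam * p.ε / 2 := by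
    have := p.Q_pos
    unfold Setup.lam
    field_simp
    ring
  have hsamp := triple_sampling (α := fun i => p.lam * p.dot Y i + p.lam * p.ε / 2)
    (β := fun i => -(p.lam * p.dot Y i) + p.lam * p.ε / 2) f1 f2 f3 (by rw [f6]; exact hsize)
    g4 g5 g6 g7 g8 g9 (by rw [f6]; exact htab) w3 ht0 hlt hge ?_ ?_
  rotate_left
  · intro i hi
    simp only [hinc]
    rw [← hvar]
    exact sum_exp_clip_le (x := fun j => p.X (i * p.d + j)) p.d_pos (hsize.trans p.le_pow) p.pow_le
      (p.norm_le i hi) hsum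
  · intro i hi
    have := sum_exp_clip_le (lam := p.lam) (x := fun j => -p.X (i * p.d + j)) (Q := p.Q) p.d_pos
      (hsize.trans p.le_pow) p.pow_le (by simpa using p.norm_le i hi) hsum
    rw [hvar] at this
    simp only [neg_mul, Finset.sum_neg_distrib, mul_neg, clip_neg] at this
    refine le_of_eq_of_le (Finset.sum_congr rfl fun q _ => ?_) this
    rw [hinc]
    split_ifs <;> simp
  -- The initial deviation is `2 * n / target`.
  have hinit : deviation p.n (fun i => p.lam * p.dot Y i + p.lam * p.ε / 2)
      (fun i => -(p.lam * p.dot Y i) + p.lam * p.ε / 2) (p.target (t + 1)) 0 (s₃.rmem 3) =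
      p.δ / ((t + 1) * (t + 2)) := by
    rw [deviation_congr (acc' := fun _ => 0) hacc]
    simp [deviation, Setup.target]
    field_simp
    ring
  rw [hinit, hT1] at hsamp
  refine hsamp.seq (T₂ := 40 * p.n + 20 * p.d + 82) ?_ (by omega)
  rintro s₄ ⟨k4, w4, hN4, hR4⟩
  have q0 : s₄.rreg 0 = alg := by rw [k4.rreg 0 (by norm_num)]; simpa using g0
  have q1 : s₄.rreg 1 = p.δ := by rw [k4.rreg 1 (by norm_num)]; simpa using g1
  have q3 : s₄.rreg 3 = p.lam := by rw [k4.rreg 3 (by norm_num)]; simpa using g3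
  have q4 : s₄.rreg 4 = 1 + p.lam * p.ε := by rw [k4.rreg 4 (by norm_num)]; simpa using g4
  have q7 : s₄.rreg 7 = m := by rw [k4.rreg 7 (by norm_num)]; simp
  have q8 : s₄.rreg 8 = 1 := by rw [k4.rreg 8 (by norm_num)]; simpa using g8
  have q9 : s₄.rreg 9 = -1 := by rw [k4.rreg 9 (by norm_num)]; simpa using g9
  have u0 : s₄.rmem 0 = p.X := by rw [hR4 0 (by norm_num), m0]
  have u1 : s₄.rmem 1 = Y := by rw [hR4 1 (by norm_num), m1]
  have u4 : s₄.rmem 4 = w := by rw [hR4 4 (by norm_num), m4]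
  have hn4 : ∀ v < 10, s₄.nreg v = s₃.nreg v := fun v hv => k4.nreg v hv
  refine Ends.triple (T := 40 * p.n + 20 * p.d + 82) (Q := fun s' => s'.nreg 0 < p.n ∧
    (∀ k < p.n, score s₄ k ≤ score s₄ (s'.nreg 0)) ∧
        Mem p (t + 1) (alg + (max (w (s'.nreg 0)) (p.dot Y (s'.nreg 0)) - w (s'.nreg 0)))
          (Function.update w (s'.nreg 0) (max (w (s'.nreg 0)) (p.dot Y (s'.nreg 0)))) s') ?_ le_rfl
    (fun s' h => ⟨h.1, h.2.2⟩) ?_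
  · refine (ends_selectBest (d := p.d) p.n_pos (by rw [hn4 2 (by norm_num), f2]) q8 w4).seq
      (T₂ := 10 * p.n + 20 * p.d + 51) ?_ (by omega)
    rintro s₅ ⟨k5, w5, hN5, hR5, hlt5, hmax⟩
    have r1 : s₅.nreg 1 = p.d := by rw [k5.nreg 1 (by norm_num), hn4 1 (by norm_num), f1]
    refine (ends_exactProduct r1 hlt5 rfl w5).seq (T₂ := 30) ?_ (by omega)
    rintro s₆ ⟨k6, w6, hN6, hR6, h10, hq⟩
    refine (ends_commit hlt5 h10 hq w6).conseq le_rfl ?_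
    rintro s₇ ⟨e0, hn7, hr0, hr7, w7, hm4, hR7⟩
    have kk := k5.trans k6
    rw [hR6, hR5, u4] at hm4
    rw [hR6, hR5, u4, kk.rreg 0 (by norm_num), q0] at hr0
    have hdot : ∑ j ∈ Finset.range p.d, s₄.rmem 0 (s₅.nreg 10 * p.d + j) * s₄.rmem 1 j =
        p.dot Y (s₅.nreg 10) := by
      rw [u0, u1]; rfl
    rw [hdot] at hm4 hr0
    have hnn : ∀ v < 10, v ≠ 0 → s₇.nreg v = s₃.nreg v := fun v hv h0 => by
      rw [hn7 v hv h0, kk.nreg v hv, hn4 v hv]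
    have hrr : ∀ v < 10, v ≠ 0 → s₇.rreg v = s₄.rreg v := fun v hv h0 => by
      rw [hr7 v hv h0, kk.rreg v hv]
    rw [e0]
    refine ⟨hlt5, hmax, ⟨?_, ?_, ?_, ?_, ?_, hr0, ?_, ?_, ?_, ?_, ?_, ?_, hm4, w7⟩⟩
    · rw [hnn 1 (by norm_num) (by norm_num), f1]
    · rw [hnn 2 (by norm_num) (by norm_num), f2]
    · rw [hnn 3 (by norm_num) (by norm_num), f3]
    · rw [hnn 4 (by norm_num) (by norm_num), f4]
    · rw [hnn 5 (by norm_num) (by norm_num), f5]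
    · rw [hrr 1 (by norm_num) (by norm_num), q1]
    · rw [hrr 3 (by norm_num) (by norm_num), q3]
    · rw [hrr 4 (by norm_num) (by norm_num), q4]
    · rw [hrr 8 (by norm_num) (by norm_num), q8]
    · rw [hrr 9 (by norm_num) (by norm_num), q9]
    · rw [hR7 0 (by norm_num), hR6, hR5, u0]
  -- A bad choice is possible only if one of the two estimates involved is far off.
  · rintro s' ⟨hi, hmax, -⟩
    split_ifs with hbad
    · obtain ⟨k, hk, hbad⟩ := hbad
      rw [← ENNReal.ofReal_one]
      refine ENNReal.ofReal_le_ofReal ?_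
      by_contra hcon
      have hall : ∀ k < p.n, |s₄.rmem 3 k / (p.lam * m) - p.dot Y k| ≤ 3 / 2 * p.ε := by
        intro k hk
        by_contra h
        exact hcon (one_le_deviation hk hm hlam p.ε_pos ht0 hge (not_le.1 h))
      have h1 := abs_le.1 (hall k hk)
      have h2 := abs_le.1 (hall _ hi)
      have h3 := hmax k hk
      simp only [score, q3, q7, u4] at h3
      linarith [h1.1, h2.2]
    · exact zero_le

/-! ### The initialization -/

theorem ends_roundUpPow {d : ℕ} {s : State} (hd : 0 < d) (h3 : s.nreg 3 = 0) (h4 : s.nreg 4 = 1)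
    (h10 : s.nreg 10 = 2 * d) :
    ∃ b, 2 * d ≤ 2 ^ b ∧ 2 ^ b ≤ 4 * d ∧ Ends (32 * d + 1) roundUpPow s (fun s' =>
      Keeps ((s.setN 4 (2 ^ b)).setN 3 b) s' ∧ s'.rmem = s.rmem ∧ s'.touched = s.touched ∧
      s'.nreg 12 = s.nreg 12 ∧ s'.rreg 10 = s.rreg 10) := by
  have hex : ∃ b, 2 * d ≤ 2 ^ b := ⟨2 * d, Nat.lt_two_pow_self.le⟩
  set b := Nat.find hex with hb
  have hb1 : 2 * d ≤ 2 ^ b := Nat.find_spec hex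
  have hlt : ∀ j < b, 2 ^ j < 2 * d := fun j hj => not_le.1 (Nat.find_min hex hj)
  have hb2 : 2 ^ b ≤ 4 * d := by
    rcases Nat.eq_zero_or_pos b with h | h
    · rw [h]
      omega
    · have := hlt (b - 1) (by omega)
      have e : 2 ^ b = 2 ^ (b - 1) * 2 := by rw [← pow_succ]; congr 1; omega
      omega
  have hb4 : b < 4 * d := lt_of_lt_of_le Nat.lt_two_pow_self hb2
  refine ⟨b, hb1, hb2, (Ends.while b (fun j s' =>
      Keeps ((s.setN 4 (2 ^ j)).setN 3 j) s' ∧ s'.rmem = s.rmem ∧ s'.touched = s.touched ∧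
      s'.nreg 12 = s.nreg 12 ∧ s'.rreg 10 = s.rreg 10 ∧ s'.nreg 10 = 2 * d) (fun _ => 7)
      ?_ ?_ ?_).conseq ?_ ?_⟩
  · rintro j hj s' ⟨hk, -, -, -, -, h10⟩
    have := hk.nreg 4 (by norm_num)
    simp at this
    simp only [Test.Holds, this, h10]
    refine ⟨fun h => lt_of_le_of_ne hj ?_, hlt j⟩
    rintro rfl
    omega
  · rintro j hj s' ⟨hk, hR, hT, h12, hr, h10⟩
    have k3 := hk.nreg 3 (by norm_num)
    have k4 := hk.nreg 4 (by norm_num)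
    simp at k3 k4
    refine Ends.of_block rfl ⟨⟨fun w hw => ?_, fun w hw => ?_⟩, ?_⟩ (by simp)
    · have := hk.nreg w hw
      simp [Instr.effect, NatOp.eval, k3, k4, show w ≠ 50 by omega] at this ⊢
      split_ifs at this ⊢
      · rfl
      · rw [pow_succ, mul_two]
      · exact this
    · simpa [Instr.effect] using hk.rreg w hw
    · simp [Instr.effect, hR, hT, h12, hr, h10]
  · refine ⟨⟨fun w hw => ?_, fun w hw => rfl⟩, rfl, rfl, rfl, rfl, h10⟩
    rcases eq_or_ne w 3 with rfl | h
    · simpa using h3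
    rcases eq_or_ne w 4 with rfl | h'
    · simpa using h4
    simp [h, h']
  · simp
    omega
  · rintro s' ⟨hk, hR, hT, h12, hr, -⟩
    exact ⟨hk, hR, hT, h12, hr⟩

theorem ends_maxSqNorm {n d : ℕ} {q₀ : ℝ} {X : ℕ → ℝ} {s : State} (h1 : s.nreg 1 = d)
    (h2 : s.nreg 2 = n) (h8 : s.rreg 8 = 1) (h12 : s.nreg 12 = 0) (h10 : s.rreg 10 = q₀)
    (hX : s.rmem 0 = X) (hs : Within n d s) :
    Ends (n * (18 * d + 21) + 3) maxSqNorm s (fun s' => Keeps s s' ∧ Within n d s' ∧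
      s'.rmem = s.rmem ∧ q₀ ≤ s'.rreg 10 ∧
      (∀ i < n, ∑ j ∈ Finset.range d, X (i * d + j) ^ 2 ≤ s'.rreg 10) ∧
      (s'.rreg 10 = q₀ ∨ ∃ i < n, s'.rreg 10 = ∑ j ∈ Finset.range d, X (i * d + j) ^ 2)) := by
  refine (Ends.forTo n (fun m s' => Keeps s s' ∧ Within n d s' ∧
      s'.rmem = s.rmem ∧ s'.nreg 12 = m * d ∧ q₀ ≤ s'.rreg 10 ∧
      (∀ i < m, ∑ j ∈ Finset.range d, X (i * d + j) ^ 2 ≤ s'.rreg 10) ∧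
      (s'.rreg 10 = q₀ ∨ ∃ i < m, s'.rreg 10 = ∑ j ∈ Finset.range d, X (i * d + j) ^ 2))
      (fun _ => 18 * d + 14) (by norm_num) ?_ ?_ ?_ ?_).conseq le_rfl ?_
  · rintro m s' ⟨hk, -⟩
    rw [hk.nreg 2 (by norm_num), h2]
  · simp [Keeps.refl, hs, h12, h10]
  · rintro m hm s' ⟨hk, hw, hR, hp, hq0, hmax, hor⟩ hi
    refine (Ends.block _ rfl s').seq (T₂ := 18 * d + 8) (fun s₁ e₁ => (Ends.forTo d
      (fun j s'' => Keeps s s'' ∧ Within n d s'' ∧ s''.rmem = s.rmem ∧ s''.nreg 12 = m * d + j ∧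
        s''.rreg 10 = s'.rreg 10 ∧ s''.nreg 11 = m ∧
        s''.rreg 11 = ∑ j' ∈ Finset.range j, X (m * d + j') ^ 2) (fun _ => 11) (by norm_num)
      ?_ ?_ ?_ le_rfl).seq (T₂ := 4) ?_ ?_) (by simp; omega)
    · rintro j s'' ⟨hk', -⟩
      rw [hk'.nreg 1 (by norm_num), h1]
    · simp [e₁, Instr.effect, hk, hw, hR, hp, hi]
    · rintro j hj s'' ⟨hk', hw', hR', hp', h10', h11', hr'⟩ hj'
      have : m * d + j < n * d := by nlinarith
      refine Ends.of_block rfl ?_ (by simp)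
      simp [Instr.effect, RealOp.eval, NatOp.eval, State.next, hk', hw', hR', hp', h10', h11', hr',
        hX, this, hj', Finset.sum_range_succ, add_assoc, pow_two]
    · rintro s₂ ⟨hk', hw', hR', hp', h10', h11', hr'⟩
      have k8 : s₂.rreg 8 = 1 := (hk'.rreg 8 (by norm_num)).trans h8
      refine Ends.ite (T := 3) (fun h => ?_) (fun h => ?_) (by norm_num)
      · simp only [Test.Holds, h10', hr'] at h
        refine Ends.of_block rfl ?_ (by simp)
        simp [Instr.effect, RealOp.eval, State.next, hk', hw', hR', hp', h11', hr', k8, add_mul]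
        refine ⟨hq0.trans h.le, fun i hi => ?_, Or.inr ⟨m, le_rfl, rfl⟩⟩
        rcases eq_or_ne i m with rfl | hne
        · exact le_rfl
        · exact (hmax i (by omega)).trans h.le
      · simp only [Test.Holds, h10', hr', not_lt] at h
        refine fun v => (Triple.skip (Q := fun s'' => s'' = _) (Φ := fun _ => v) rfl).conseq
          (by norm_num) ?_ (fun _ _ => le_rfl) le_rfl
        rintro _ rfl
        simp [State.next, hk', hw', hR', hp', h10', h11', hq0, add_mul]
        refine ⟨fun i hi => ?_, hor.imp_right ?_⟩
        · rcases eq_or_ne i m with rfl | hne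
          · exact h
          · exact hmax i (by omega)
        · rintro ⟨i, hi, h⟩
          exact ⟨i, by omega, h⟩
    · simp
      omega
  · simp
  · rintro s' ⟨hk, hw, hR, -, hq⟩
    exact ⟨hk, hw, hR, hq⟩

/-- The coordinates of the offline points, row by row. -/
noncomputable def coords {n d : ℕ} (x : Fin n → Point d) (k : ℕ) : ℝ :=
  if h : k < n * d then x (finProdFinEquiv.symm ⟨k, h⟩).1 (finProdFinEquiv.symm ⟨k, h⟩).2 else 0

theorem coords_eq {n d : ℕ} (x : Fin n → Point d) (i : Fin n) (j : Fin d) :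
    coords x (i * d + j) = x i j := by
  have e : (i : ℕ) * d + j = (finProdFinEquiv (i, j) : Fin (n * d)) := by
    rw [finProdFinEquiv_apply_val, add_comm, mul_comm]
  have h : (i : ℕ) * d + j < n * d := e ▸ (finProdFinEquiv (i, j)).2
  have : (⟨(i : ℕ) * d + j, h⟩ : Fin (n * d)) = finProdFinEquiv (i, j) := Fin.ext e
  rw [coords, dif_pos h, this, Equiv.symm_apply_apply]

theorem sum_coords_sq {n d : ℕ} (x : Fin n → Point d) (i : Fin n) :
    ∑ j ∈ Finset.range d, coords x (i * d + j) ^ 2 = ‖x i‖ ^ 2 := by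
  rw [EuclideanSpace.real_norm_sq_eq, Finset.sum_range]
  exact Finset.sum_congr rfl fun j _ => by rw [coords_eq]

theorem startState_rmem {n d : ℕ} (x : Fin n → Point d) (ε δ : ℝ) :
    (startState x ε δ).rmem 0 = coords x := by
  funext k
  simp [startState, coords]

/-- The setup belongs to the input of the initialization. -/
structure Setup.Fits {n d : ℕ} (p : Setup) (x : Fin n → Point d) (ε δ κ : ℝ) : Prop where
  n_eq : p.n = n
  d_eq : p.d = d
  ε_eq : p.ε = ε
  δ_eq : p.δ = δ
  X_eq : p.X = coords x
  Q_le : p.Q ≤ κ * ε ^ 2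

/-- The initialization always ends within `150 * (n * d)` steps, with the empty matching. The bound
`Q` it computes is at most `max 1 (D / ε) ^ 2 * ε ^ 2`, although it does not know `D`. -/
theorem ends_initProg {n d : ℕ} {ε δ D : ℝ} (x : Fin n → Point d) (hn : 0 < n) (hd : 0 < d)
    (hε : 0 < ε) (hδ : 0 < δ) (hδ1 : δ < 1) (hx : ∀ i, ‖x i‖ ≤ D) :
    Ends (150 * (n * d)) initProg (startState x ε δ) (fun s' => ∃ p : Setup,
      p.Fits x ε δ (max 1 (ε⁻¹ ^ 2 * D ^ 2)) ∧ Mem p 0 0 (fun _ => 0) s') := by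
  have hnd : d ≤ n * d := Nat.le_mul_of_pos_left d hn
  have hnd' : n ≤ n * d := Nat.le_mul_of_pos_right n hd
  refine (Ends.block _ rfl _).seq (T₂ := 100 * (n * d) + 20) ?_ (by simp; omega)
  intro s₁ e₁
  have hstart : (startState x ε δ).nreg 1 = d := by simp [startState]
  have hstart0 : (startState x ε δ).nreg 0 = n := by simp [startState]
  have hs0 : (startState x ε δ).rreg 0 = ε := by simp [startState]
  have hs1 : (startState x ε δ).rreg 1 = δ := by simp [startState]
  have hw0 : Within n d (startState x ε δ) := by
    intro c hc
    simp only [startState, Finset.mem_image, Finset.mem_range] at hc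
    obtain ⟨k, hk, rfl⟩ := hc
    simp [hk]
  have a1 : s₁.nreg 1 = d := by simp [e₁, Instr.effect, hstart]
  have a2 : s₁.nreg 2 = n := by simp [e₁, Instr.effect, NatOp.eval, hstart0]
  have a3 : s₁.nreg 3 = 0 := by simp [e₁, Instr.effect]
  have a4 : s₁.nreg 4 = 1 := by simp [e₁, Instr.effect]
  have a5 : s₁.nreg 5 = 0 := by simp [e₁, Instr.effect]
  have a10 : s₁.nreg 10 = 2 * d := by simp [e₁, Instr.effect, NatOp.eval, hstart]; omega
  have a12 : s₁.nreg 12 = 0 := by simp [e₁, Instr.effect]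
  have b0 : s₁.rreg 0 = 0 := by simp [e₁, Instr.effect, RealOp.eval]
  have b1 : s₁.rreg 1 = δ := by simp [e₁, Instr.effect, hs1]
  have b2 : s₁.rreg 2 = ε := by simp [e₁, Instr.effect, RealOp.eval, hs0]
  have b8 : s₁.rreg 8 = 1 := by simp [e₁, Instr.effect]
  have b9 : s₁.rreg 9 = -1 := by simp [e₁, Instr.effect, RealOp.eval]
  have b10 : s₁.rreg 10 = ε ^ 2 := by simp [e₁, Instr.effect, RealOp.eval, hs0, pow_two]
  have c0 : s₁.rmem 0 = coords x := by simp [e₁, Instr.effect, startState_rmem]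
  have c4 : s₁.rmem 4 = fun _ => 0 := by funext; simp [e₁, Instr.effect, startState]
  have w1 : Within n d s₁ := by simp [e₁, Instr.effect, hw0]
  obtain ⟨b, hb1, hb2, hends⟩ := ends_roundUpPow hd a3 a4 a10
  refine hends.seq (T₂ := 60 * (n * d) + 18) ?_ (by omega)
  rintro s₂ ⟨k2, hR2, hT2, h12, h10⟩
  have w2 : Within n d s₂ := by unfold Within; rw [hT2]; exact w1
  have d1 : s₂.nreg 1 = d := by rw [k2.nreg 1 (by norm_num)]; simpa using a1
  have d2 : s₂.nreg 2 = n := by rw [k2.nreg 2 (by norm_num)]; simpa using a2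
  have f8 : s₂.rreg 8 = 1 := by rw [k2.rreg 8 (by norm_num)]; simpa using b8
  refine (ends_maxSqNorm d1 d2 f8 (h12.trans a12) (h10.trans b10) (by rw [hR2, c0]) w2).seq
    (T₂ := 13) ?_ (by nlinarith)
  rintro s₃ ⟨k3, w3, hR3, hq0, hq, hor⟩
  have k := k2.trans k3
  have hκ : s₃.rreg 10 ≤ max 1 (ε⁻¹ ^ 2 * D ^ 2) * ε ^ 2 := by
    rcases hor with h | ⟨i, hi, h⟩
    · rw [h]
      nlinarith [le_max_left 1 (ε⁻¹ ^ 2 * D ^ 2), pow_pos hε 2]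
    · have e := sum_coords_sq x ⟨i, hi⟩
      simp only at e
      rw [h, e]
      have h1 : ‖x ⟨i, hi⟩‖ ^ 2 ≤ D ^ 2 := by
        have := hx ⟨i, hi⟩
        gcongr
      have h2 : ε⁻¹ ^ 2 * D ^ 2 * ε ^ 2 = D ^ 2 := by field_simp
      have h3 : ε⁻¹ ^ 2 * D ^ 2 * ε ^ 2 ≤ max 1 (ε⁻¹ ^ 2 * D ^ 2) * ε ^ 2 := by
        gcongr
        exact le_max_right _ _
      linarith
  have g0 : s₃.rreg 0 = 0 := by rw [k.rreg 0 (by norm_num)]; simpa using b0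
  have g1 : s₃.rreg 1 = δ := by rw [k.rreg 1 (by norm_num)]; simpa using b1
  have g2 : s₃.rreg 2 = ε := by rw [k.rreg 2 (by norm_num)]; simpa using b2
  have g8 : s₃.rreg 8 = 1 := by rw [k.rreg 8 (by norm_num)]; simpa using b8
  have g9 : s₃.rreg 9 = -1 := by rw [k.rreg 9 (by norm_num)]; simpa using b9
  refine Ends.of_block rfl ⟨⟨n, d, b, coords x, ε, δ, s₃.rreg 10, hn, hd, hb1, hb2, hε, hδ, hδ1,
    hq0, hq⟩, ⟨rfl, rfl, rfl, rfl, rfl, hκ⟩, ?_⟩ (by simp)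
  refine ⟨?_, ?_, ?_, ?_, ?_, ?_, ?_, ?_, ?_, ?_, ?_, ?_, ?_, ?_⟩
  · simp [Instr.effect, k.nreg, a1]
  · simp [Instr.effect, k.nreg, a2]
  · simp [Instr.effect, k.nreg]
  · simp [Instr.effect, k.nreg]
  · simp [Instr.effect, k.nreg, a5]
  · simp [Instr.effect, g0]
  · simp [Instr.effect, g1]
  · simp [Instr.effect, RealOp.eval, g2, Setup.lam]
  · simp [Instr.effect, RealOp.eval, g2, g8, Setup.lam]
  · simp [Instr.effect, g8]
  · simp [Instr.effect, g9]
  · simp [Instr.effect, hR3, hR2, c0]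
  · simp [Instr.effect, hR3, hR2, c4]
  · simpa [Instr.effect] using w3

/-! ### The number of samples -/

/-- The number of samples of update `t` is logarithmic in the target over the growth rate, which is
at least `1 / (8 * κ)`. -/
theorem exists_rounds {p : Setup} {κ : ℝ} (hκ1 : 1 ≤ κ) (hκ : p.Q ≤ κ * p.ε ^ 2) (t : ℕ)
    (ht : 0 < t) :
    ∃ m : ℕ, (∀ j < m, (1 + p.lam * p.ε) ^ j < p.target t) ∧
      p.target t ≤ (1 + p.lam * p.ε) ^ m ∧
      (m : ℝ) ≤ 48 * κ * (1 + Real.log (max (p.n : ℝ) t / p.δ)) + 1 := by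
  have hQ := p.Q_pos
  have hε := p.ε_pos
  have hδ := p.δ_pos
  have hδ1 := p.δ_lt
  set u := p.lam * p.ε with hu
  have hu' : u = p.ε ^ 2 / (8 * p.Q) := by
    rw [hu, Setup.lam]
    ring
  have hupos : 0 < u := mul_pos p.lam_pos hε
  have hu1 : u ≤ 1 := by
    rw [hu', div_le_one (by positivity)]
    have := p.le_Q
    linarith
  have huκ : 1 / u ≤ 8 * κ := by
    rw [hu', one_div_div, div_le_iff₀ (by positivity)]
    linarith
  have hexp : Real.exp (u / 2) ≤ 1 + u := by
    have := abs_le.1 (Real.abs_exp_sub_one_sub_id_le (x := u / 2)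
      (abs_le.2 ⟨by linarith, by linarith⟩))
    nlinarith [this.2]
  set M : ℝ := max (p.n : ℝ) t with hM
  have hn1 : (1 : ℝ) ≤ p.n := by exact_mod_cast p.n_pos
  have ht1 : (1 : ℝ) ≤ t := by exact_mod_cast ht
  have hMn : (p.n : ℝ) ≤ M := le_max_left _ _
  have hMt : (t : ℝ) ≤ M := le_max_right _ _
  have hM1 : 1 ≤ M := hn1.trans hMn
  have hMδ : M ≤ M / p.δ := by
    rw [le_div_iff₀ hδ]
    nlinarith
  have htpos : 0 < p.target t := by
    unfold Setup.target
    positivity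
  have htarget : p.target t ≤ 4 * (M / p.δ) ^ 3 := by
    have h1 : p.target t ≤ 4 * (M / p.δ * M * M) := by
      have e : 4 * (M / p.δ * M * M) = 4 * M * M * M / p.δ := by ring
      rw [e, Setup.target]
      have h2 : 2 * (p.n : ℝ) * t * (t + 1) ≤ 2 * M * M * (2 * M) := by
        gcongr
        linarith
      refine div_le_div_of_nonneg_right ?_ hδ.le
      linarith
    refine h1.trans ?_
    rw [pow_three', mul_assoc (M / p.δ)]
    have : M * M ≤ M / p.δ * (M / p.δ) := by gcongr
    nlinarith [hM1.trans hMδ]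
  have hlog : Real.log (p.target t) ≤ 3 * (1 + Real.log (M / p.δ)) := by
    refine (Real.log_le_log htpos htarget).trans ?_
    rw [Real.log_mul (by norm_num) (by positivity), Real.log_pow]
    have := Real.log_le_sub_one_of_pos (show (0 : ℝ) < 4 by norm_num)
    push_cast
    linarith
  have hL0 : 0 ≤ 1 + Real.log (M / p.δ) := by
    have := Real.log_nonneg (hM1.trans hMδ)
    linarith
  set k := ⌈2 * (3 * (1 + Real.log (M / p.δ))) * (8 * κ)⌉₊ with hk
  have hkge : p.target t ≤ (1 + u) ^ k := by
    rw [← Real.exp_log htpos]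
    refine le_trans (Real.exp_le_exp.2 ?_) ((Real.exp_nat_mul (u / 2) k).trans_le
      (pow_le_pow_left₀ (Real.exp_pos _).le hexp k))
    refine hlog.trans ?_
    have h1 : 2 * (3 * (1 + Real.log (M / p.δ))) * (8 * κ) ≤ k := Nat.le_ceil _
    have h2 : 2 * (3 * (1 + Real.log (M / p.δ))) * (1 / u) ≤ k :=
      le_trans (by gcongr) h1
    have h3 : 2 * (3 * (1 + Real.log (M / p.δ))) ≤ k * u := by
      rwa [mul_one_div, div_le_iff₀ hupos] at h2
    linarith
  have hex : ∃ m : ℕ, p.target t ≤ (1 + u) ^ m := ⟨k, hkge⟩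
  refine ⟨Nat.find hex, fun j hj => not_le.1 (Nat.find_min hex hj), Nat.find_spec hex, ?_⟩
  have h1 : ((Nat.find hex : ℕ) : ℝ) ≤ k := by exact_mod_cast Nat.find_min' hex hkge
  have h2 : (k : ℝ) < 2 * (3 * (1 + Real.log (M / p.δ))) * (8 * κ) + 1 :=
    Nat.ceil_lt_add_one (by positivity)
  linarith

/-! ### The greedy matching -/

/-- The value that the online points matched to the offline point `u` contribute. -/
noncomputable def offlineValue {n d m : ℕ} (x : Fin n → Point d) (y : Fin m → Point d)
    (σ : Fin m → Fin n) (u : Fin n) : ℝ :=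
  (Finset.univ.filter fun v => σ v = u).fold max 0 fun v => inner ℝ (x u) (y v)

/-- The effect of one more online point, the one with index 0. -/
theorem offlineValue_succ {n d m : ℕ} (x : Fin n → Point d) (y : Fin (m + 1) → Point d)
    (σ : Fin (m + 1) → Fin n) (u : Fin n) :
    offlineValue x y σ u = if σ 0 = u then
      max (offlineValue x (fun v => y v.succ) (fun v => σ v.succ) u) (inner ℝ (x u) (y 0))
      else offlineValue x (fun v => y v.succ) (fun v => σ v.succ) u := by
  refine eq_of_forall_ge_iff fun c => ?_
  split_ifs with h
  · rw [max_le_iff, offlineValue, offlineValue, Finset.fold_max_le, Finset.fold_max_le]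
    simp [Fin.forall_fin_succ, h]
    tauto
  · rw [offlineValue, offlineValue, Finset.fold_max_le, Finset.fold_max_le]
    simp [Fin.forall_fin_succ, h]

/-- The value at the offline point `u` when the online points have been matched as listed, latest
first. -/
noncomputable def load {n d : ℕ} (x : Fin n → Point d) : List (Point d × Fin n) → Fin n → ℝ
  | [], _ => 0
  | (y, i) :: l, u => if i = u then max (load x l u) (inner ℝ (x u) y) else load x l u

theorem offlineValue_get {n d : ℕ} (x : Fin n → Point d) (l : List (Point d × Fin n))
    (u : Fin n) :
    offlineValue x (fun v : Fin l.length => (l.get v).1) (fun v => (l.get v).2) u = load x l u := by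
  induction l with
  | nil => simp [offlineValue, load]
  | cons a l ih =>
    rw [load, ← ih]
    exact offlineValue_succ x (fun v : Fin (l.length + 1) => ((a :: l).get v).1) _ u

theorem alg_eq {n d : ℕ} (x : Fin n → Point d) (h : History n d) :
    History.alg x h = ∑ u, load x (arrivals h) u := by
  simp only [← offlineValue_get]
  rfl

/-- Every online point was matched to an offline point whose gain was greatest up to `3 * ε`. -/
def Greedy {n d : ℕ} (x : Fin n → Point d) (ε : ℝ) : List (Point d × Fin n) → Prop
  | [] => True
  | (y, i) :: l => Greedy x ε l ∧
      ∀ k, inner ℝ (x k) y - load x l k ≤ inner ℝ (x i) y - load x l i + 3 * ε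

theorem Greedy.of_append {n d : ℕ} {x : Fin n → Point d} {ε : ℝ} {l₁ l₂ : List (Point d × Fin n)}
    (h : Greedy x ε (l₁ ++ l₂)) : Greedy x ε l₂ := by
  induction l₁ with
  | nil => exact h
  | cons a l₁ ih => exact ih h.1

theorem sum_load_cons {n d : ℕ} (x : Fin n → Point d) (y : Point d) (i : Fin n)
    (l : List (Point d × Fin n)) :
    ∑ u, load x ((y, i) :: l) u =
      ∑ u, load x l u + (max (load x l i) (inner ℝ (x i) y) - load x l i) := by
  have : ∀ u, load x ((y, i) :: l) u = load x l u +
      if i = u then max (load x l u) (inner ℝ (x u) y) - load x l u else 0 := by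
    intro u
    rw [load]
    split_ifs <;> ring
  simp [this, Finset.sum_add_distrib]

/-- The values of any other matching exceed those of the greedy one by at most its value and the
errors in total. -/
theorem Greedy.sum_excess_le {n d : ℕ} {x : Fin n → Point d} {ε : ℝ} (hε : 0 ≤ ε)
    {l : List (Point d × Fin n)} (hl : Greedy x ε l) (σ : Fin l.length → Fin n) :
    ∑ u, (max (offlineValue x (fun v : Fin l.length => (l.get v).1) σ u) (load x l u) -
        load x l u) ≤
      ∑ u, load x l u + 3 * l.length * ε := by
  induction l with
  | nil => simp [offlineValue, load]
  | cons a l ih =>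
    obtain ⟨y, i⟩ := a
    obtain ⟨hl, hi⟩ := hl
    have hih := ih hl fun v => σ v.succ
    set V := offlineValue x (fun v : Fin l.length => (l.get v).1) fun v => σ v.succ with hV
    set k := σ 0 with hk
    have hV' : ∀ u, offlineValue x
        (fun v : Fin ((y, i) :: l).length => (((y, i) :: l).get v).1) σ u =
        if k = u then max (V u) (inner ℝ (x u) y) else V u :=
      fun u => offlineValue_succ x (fun v : Fin (l.length + 1) => (((y, i) :: l).get v).1) σ u
    have hterm : ∀ u, max (offlineValue x
        (fun v : Fin ((y, i) :: l).length => (((y, i) :: l).get v).1) σ u)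
          (load x ((y, i) :: l) u) - load x ((y, i) :: l) u ≤
        (max (V u) (load x l u) - load x l u) +
          if k = u then max (load x l u) (inner ℝ (x u) y) - load x l u else 0 := by
      intro u
      rw [hV', load]
      -- A greater value of the greedy matching makes the excess smaller.
      have hmono : ∀ a b c : ℝ, b ≤ c → max a c - c ≤ max a b - b := by
        intro a b c h
        rcases le_total a c with h1 | h1
        · rw [max_eq_right h1]
          linarith [le_max_right a b]
        · rw [max_eq_left h1]
          linarith [le_max_left a b]
      have h1 : load x l u ≤
          if i = u then max (load x l u) (inner ℝ (x u) y) else load x l u := by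
        split_ifs
        · exact le_max_left _ _
        · exact le_rfl
      refine (hmono _ _ _ h1).trans ?_
      split_ifs
      · have h2 : max (max (V u) (inner ℝ (x u) y)) (load x l u) ≤
            max (V u) (load x l u) + (max (load x l u) (inner ℝ (x u) y) - load x l u) := by
          refine max_le (max_le ?_ ?_) ?_
          · linarith [le_max_left (V u) (load x l u), le_max_left (load x l u) (inner ℝ (x u) y)]
          · linarith [le_max_right (V u) (load x l u), le_max_right (load x l u) (inner ℝ (x u) y)]
          · linarith [le_max_right (V u) (load x l u), le_max_left (load x l u) (inner ℝ (x u) y)]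
        linarith
      · linarith
    refine (Finset.sum_le_sum fun u _ => hterm u).trans ?_
    rw [Finset.sum_add_distrib, sum_load_cons]
    simp only [Finset.sum_ite_eq, Finset.mem_univ, if_true, List.length_cons, Nat.cast_add,
      Nat.cast_one]
    have h3 : max (load x l k) (inner ℝ (x k) y) - load x l k ≤
        max (load x l i) (inner ℝ (x i) y) - load x l i + 3 * ε := by
      have := hi k
      have h4 := le_max_left (load x l i) (inner ℝ (x i) y)
      have h5 := le_max_right (load x l i) (inner ℝ (x i) y)
      rcases le_total (load x l k) (inner ℝ (x k) y) with h | h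
      · rw [max_eq_right h]
        linarith
      · rw [max_eq_left h]
        linarith
    linarith

/-- A greedy matching with errors `3 * ε` is, up to these errors, half as good as any other. -/
theorem Greedy.half_opt_le {n d : ℕ} {x : Fin n → Point d} {ε : ℝ} (hε : 0 ≤ ε) (hn : 0 < n)
    {h : History n d} (hh : Greedy x ε (arrivals h)) :
    History.alg x h ≥
      (1 / 2) * History.opt x h - (3 / 2) * (History.numOnline h : ℝ) * ε := by
  have : Nonempty (Fin n) := ⟨⟨0, hn⟩⟩
  have hopt : History.opt x h ≤ 2 * History.alg x h + 3 * (History.numOnline h : ℝ) * ε := by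
    refine ciSup_le fun σ => ?_
    have h1 := hh.sum_excess_le hε σ
    rw [Finset.sum_sub_distrib, ← alg_eq] at h1
    have h2 : matchingValue x (fun v : Fin (arrivals h).length => ((arrivals h).get v).1) σ ≤
        ∑ u, max (offlineValue x (fun v : Fin (arrivals h).length => ((arrivals h).get v).1) σ u)
          (load x (arrivals h) u) := Finset.sum_le_sum fun u _ => le_max_left _ _
    unfold History.numOnline
    linarith
  linarith

/-! ### Sessions -/

/-- The three procedures. The value of the matching is always kept in real register 0, so a query
has nothing to compute. -/
def greedyStructure : DataStructure := ⟨initProg, updateProg, .skip⟩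

/-- The values at the offline points, as an array. -/
noncomputable def loadArray {n d : ℕ} (x : Fin n → Point d) (l : List (Point d × Fin n)) (k : ℕ) :
    ℝ :=
  if h : k < n then load x l ⟨k, h⟩ else 0

/-- The invariant between two requests. -/
structure Valid {n d : ℕ} (x : Fin n → Point d) (ε δ κ : ℝ) (s : State) (h : History n d) :
    Prop where
  mem : ∃ p : Setup, p.Fits x ε δ κ ∧
    Mem p h.numOnline (h.alg x) (loadArray x (arrivals h)) s
  answers : ∀ (a : ℝ) (h' : History n d), (Event.answered a :: h') <:+ h → a = History.alg x h'

theorem Mem.loadPoint {p : Setup} {t : ℕ} {alg : ℝ} {w : ℕ → ℝ} {s : State}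
    (hs : Mem p t alg w s) (y : Point p.d) : Mem p t alg w (loadPoint y s) := by
  refine ⟨hs.n1, hs.n2, hs.n3, hs.n4, hs.n5, hs.r0, hs.r1, hs.r3, hs.r4, hs.r8, hs.r9, ?_, ?_, ?_⟩
  · funext k
    simp [OnlineMatching.loadPoint, hs.m0]
  · funext k
    simp [OnlineMatching.loadPoint, hs.m4]
  · intro c hc
    rw [OnlineMatching.loadPoint, Finset.mem_union, Finset.mem_image] at hc
    rcases hc with hc | ⟨k, hk, rfl⟩
    · exact hs.within c hc
    · simp [Finset.mem_range.1 hk]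

theorem loadPoint_rmem_one {d : ℕ} (y : Point d) (s : State) (j : Fin d) :
    (loadPoint y s).rmem 1 j = y j := by
  simp [loadPoint]

/-- The failure potential of a session: one if an online point has been matched badly, and otherwise
the probability, by the union bound, that this happens later. -/
noncomputable def failurePotential {n d : ℕ} (x : Fin n → Point d) (ε δ : ℝ)
    (o : Option (State × History n d)) : ℝ≥0∞ :=
  open Classical in match o with
  | none => 1
  | some (_, h) => if Greedy x ε (arrivals h) then ENNReal.ofReal (δ / (h.numOnline + 1)) else 1

theorem failure_le_one {n d : ℕ} {x : Fin n → Point d} {ε δ : ℝ} (hδ : δ < 1)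
    (o : Option (State × History n d)) : failurePotential x ε δ o ≤ 1 := by
  unfold failurePotential
  split
  · exact le_rfl
  · split_ifs
    · rw [← ENNReal.ofReal_one]
      refine ENNReal.ofReal_le_ofReal ?_
      rw [div_le_one (by positivity)]
      linarith [Nat.cast_nonneg (α := ℝ) (History.numOnline ‹_›)]
    · exact le_rfl

/-- One update keeps the invariant and, in expectation, does not increase the failure potential. -/
theorem serve_update {n d : ℕ} {x : Fin n → Point d} {ε δ κ : ℝ} {B : Budget} {A : Adversary n d}
    {s : State} {h : History n d} {y : Point d} (hκ : 1 ≤ κ)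
    (hB : ∀ t m : ℕ, 0 < t → (m : ℝ) ≤ 48 * κ * (1 + Real.log (max (n : ℝ) t / δ)) + 1 →
      150 * (n + d) * (m + 1) ≤ B.update t)
    (hA : A h = .update y) (hy : ‖y‖ ≤ 1) (hs : Valid x ε δ κ s h) :
    (∀ o ∈ (serve greedyStructure B A s h).support,
      ∃ s' h', o = some (s', h') ∧ Valid x ε δ κ s' h') ∧
    expect (serve greedyStructure B A s h) (failurePotential x ε δ) ≤
      failurePotential x ε δ (some (s, h)) := by
  obtain ⟨⟨p, ⟨rfl, rfl, rfl, rfl, hX, hQ⟩, hmem⟩, hans⟩ := hs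
  set t := h.numOnline with ht
  obtain ⟨m, hlt, hge, hm⟩ := exists_rounds hκ hQ (t + 1) t.succ_pos
  set Y := (loadPoint y s).rmem 1 with hYdef
  have hYj : ∀ j : Fin p.d, Y j = y j := loadPoint_rmem_one y s
  have hY : ∑ j ∈ Finset.range p.d, Y j ^ 2 ≤ 1 := by
    rw [Finset.sum_range]
    simp only [hYj]
    rw [← EuclideanSpace.real_norm_sq_eq]
    exact pow_le_one₀ (norm_nonneg _) hy
  have hdot : ∀ k : Fin p.n, p.dot Y k = inner ℝ (x k) y := by
    intro k
    rw [Setup.dot, Finset.sum_range, PiLp.inner_apply]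
    refine Finset.sum_congr rfl fun j _ => ?_
    rw [hYj, hX, coords_eq]
    simp [mul_comm]
  have hload : ∀ k : Fin p.n, loadArray x (arrivals h) k = load x (arrivals h) k := by
    intro k
    simp [loadArray]
  have htri := triple_updateProg (hmem.loadPoint y) rfl hY hlt hge
  obtain ⟨hsupp, hexp⟩ := htri.exec (hB (t + 1) m t.succ_pos hm)
  have hserve : serve greedyStructure B A s h =
      (exec (B.update (t + 1)) updateProg (loadPoint y s)).map fun o =>
        o.bind fun s' =>
          if hi : s'.nreg 0 < p.n then some (s', .matched y ⟨s'.nreg 0, hi⟩ :: h) else none := by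
    rw [serve, hA]
    rfl
  rw [hserve]
  constructor
  · intro o ho
    rw [PMF.mem_support_map_iff] at ho
    obtain ⟨o', ho', rfl⟩ := ho
    obtain ⟨s', rfl, hi, hmem'⟩ := hsupp o' ho'
    refine ⟨s', .matched y ⟨s'.nreg 0, hi⟩ :: h, by simp [hi],
      ⟨p, ⟨rfl, rfl, rfl, rfl, hX, hQ⟩, ?_⟩, ?_⟩
    · have e1 : arrivals (Event.matched y ⟨s'.nreg 0, hi⟩ :: h) =
          (y, ⟨s'.nreg 0, hi⟩) :: arrivals h := rfl
      have e2 : History.numOnline (Event.matched y ⟨s'.nreg 0, hi⟩ :: h) = t + 1 := rfl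
      have hd0 := hdot ⟨s'.nreg 0, hi⟩
      have hl0 := hload ⟨s'.nreg 0, hi⟩
      simp only at hd0 hl0
      rw [e2, alg_eq, e1, sum_load_cons, ← alg_eq]
      rw [hd0, hl0] at hmem'
      convert hmem' using 1
      funext k
      rcases eq_or_ne k (s'.nreg 0) with rfl | hne
      · simp [loadArray, load, hi]
      · rw [Function.update_of_ne hne, loadArray, loadArray]
        split_ifs with hk
        · rw [load, if_neg]
          intro hcon
          exact hne (congrArg Fin.val hcon).symm
        · rfl
    · intro a h' hsuf
      rcases List.suffix_cons_iff.1 hsuf with heq | hsuf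
      · cases heq
      · exact hans a h' hsuf
  · by_cases hg : Greedy x p.ε (arrivals h)
    · rw [expect_map]
      have hfail : failurePotential x p.ε p.δ (some (s, h)) = ENNReal.ofReal (p.δ / (t + 2)) +
          ENNReal.ofReal (p.δ / ((t + 1) * (t + 2))) := by
        have hδ := p.δ_pos
        rw [← ENNReal.ofReal_add (by positivity) (by positivity)]
        simp only [failurePotential, hg, if_true]
        congr 1
        rw [← ht]
        field_simp
        ring
      rw [hfail]
      classical
      set bad : Option State → ℝ≥0∞ := fun o => o.elim 0 fun s' =>
        if ∃ k < p.n, p.dot Y (s'.nreg 0) - loadArray x (arrivals h) (s'.nreg 0) + 3 * p.ε <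
          p.dot Y k - loadArray x (arrivals h) k then 1 else 0 with hbad
      -- The choice is bad with probability at most `δ / ((t + 1) * (t + 2))`, which pays for the
      -- difference between the potentials `δ / (t + 1)` and `δ / (t + 2)`.
      refine le_trans (expect_mono (g := fun o => ENNReal.ofReal (p.δ / (t + 2)) + bad o) ?_) ?_
      · intro o ho
        obtain ⟨s', rfl, hi, -⟩ := hsupp o ho
        simp only [Option.bind_some, hi, dif_pos, hbad, Option.elim_some]
        split_ifs with hb
        · exact (failure_le_one p.δ_lt _).trans le_add_self
        · rw [add_zero]
          push Not at hb
          have hgreedy : Greedy x p.ε (arrivals (Event.matched y ⟨s'.nreg 0, hi⟩ :: h)) := by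
            refine ⟨hg, fun k => ?_⟩
            have := hb k k.2
            have hd0 := hdot ⟨s'.nreg 0, hi⟩
            have hl0 := hload ⟨s'.nreg 0, hi⟩
            simp only at hd0 hl0
            rwa [hdot, hload, hd0, hl0] at this
          have e2 : History.numOnline (Event.matched y ⟨s'.nreg 0, hi⟩ :: h) = t + 1 := rfl
          simp only [failurePotential, hgreedy, if_true, e2]
          refine (congrArg ENNReal.ofReal ?_).le
          push_cast
          ring
      · rw [expect_add, expect_const]
        gcongr
        refine hexp bad fun s' _ => le_of_eq ?_
        simp only [hbad, Option.elim_some]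
        congr
    · have : failurePotential x p.ε p.δ (some (s, h)) = 1 := by simp [failurePotential, hg]
      rw [this]
      exact (expect_mono fun o _ => failure_le_one p.δ_lt o).trans (expect_const _ _).le

/-- Likewise for a query, which changes nothing and is answered correctly. -/
theorem serve_query {n d : ℕ} {x : Fin n → Point d} {ε δ κ : ℝ} {B : Budget} {A : Adversary n d}
    {s : State} {h : History n d} (hB : 1 ≤ B.query) (hA : A h = .query)
    (hs : Valid x ε δ κ s h) :
    (∀ o ∈ (serve greedyStructure B A s h).support,
      ∃ s' h', o = some (s', h') ∧ Valid x ε δ κ s' h') ∧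
    expect (serve greedyStructure B A s h) (failurePotential x ε δ) ≤
      failurePotential x ε δ (some (s, h)) := by
  have hserve : serve greedyStructure B A s h =
      (exec B.query .skip s).map fun o => o.map fun s' => (s', .answered (s'.rreg 0) :: h) := by
    rw [serve, hA]
    rfl
  obtain ⟨hsupp, hexp⟩ := (Triple.skip (s := s) (Q := (· = s))
    (Φ := fun _ => failurePotential x ε δ (some (s, h))) rfl).exec hB
  rw [hserve]
  constructor
  · intro o ho
    rw [PMF.mem_support_map_iff] at ho
    obtain ⟨o', ho', rfl⟩ := ho
    obtain ⟨s', rfl, rfl⟩ := hsupp o' ho'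
    obtain ⟨⟨p, hp, hmem⟩, hans⟩ := hs
    refine ⟨s', _, rfl, ⟨p, hp, hmem⟩, ?_⟩
    intro a h' hsuf
    rcases List.suffix_cons_iff.1 hsuf with heq | hsuf
    · cases heq
      exact hmem.r0
    · exact hans a h' hsuf
  · rw [expect_map]
    refine hexp _ ?_
    rintro s' rfl
    exact le_rfl

/-- In every session the invariant holds, and the expected failure potential is at most `δ`. -/
theorem session_spec {n d : ℕ} {x : Fin n → Point d} {ε δ κ : ℝ} {B : Budget} {A : Adversary n d}
    (hκ : 1 ≤ κ)
    (hinit : Ends B.init initProg (startState x ε δ) (fun s' => ∃ p : Setup,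
      p.Fits x ε δ κ ∧ Mem p 0 0 (fun _ => 0) s'))
    (hupdate : ∀ t m : ℕ, 0 < t → (m : ℝ) ≤ 48 * κ * (1 + Real.log (max (n : ℝ) t / δ)) + 1 →
      150 * (n + d) * (m + 1) ≤ B.update t)
    (hquery : 1 ≤ B.query) (hA : ∀ h y, A h = Request.update y → ‖y‖ ≤ 1) (r : ℕ) :
    (∀ o ∈ (session greedyStructure B x ε δ A r).support,
      ∃ s h, o = some (s, h) ∧ Valid x ε δ κ s h) ∧
    expect (session greedyStructure B x ε δ A r) (failurePotential x ε δ) ≤ ENNReal.ofReal δ := by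
  induction r with
  | zero =>
    obtain ⟨hsupp, hexp⟩ := (hinit (ENNReal.ofReal δ)).exec le_rfl
    rw [session]
    constructor
    · intro o ho
      rw [PMF.mem_support_map_iff] at ho
      obtain ⟨o', ho', rfl⟩ := ho
      obtain ⟨s', rfl, p, hp, hmem⟩ := hsupp o' ho'
      refine ⟨s', [], rfl, ⟨p, hp, ?_⟩, ?_⟩
      · have e1 : History.alg x ([] : History n d) = 0 := by
          rw [alg_eq]
          exact Finset.sum_eq_zero fun _ _ => rfl
        have e2 : loadArray x (arrivals ([] : History n d)) = fun _ => 0 := by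
          funext k
          unfold loadArray
          split_ifs <;> rfl
        rw [e1, e2]
        exact hmem
      · intro a h' hsuf
        simp at hsuf
    · rw [expect_map]
      refine hexp _ fun s' _ => ?_
      simp [failurePotential, arrivals, Greedy, History.numOnline]
  | succ r ih =>
    have hserve : ∀ s h, Valid x ε δ κ s h →
        (∀ o ∈ (serve greedyStructure B A s h).support,
          ∃ s' h', o = some (s', h') ∧ Valid x ε δ κ s' h') ∧
        expect (serve greedyStructure B A s h) (failurePotential x ε δ) ≤
      failurePotential x ε δ (some (s, h)) := by
      intro s h hs
      cases hreq : A h with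
      | update y => exact serve_update hκ hupdate hreq (hA h y hreq) hs
      | query => exact serve_query hquery hreq hs
    rw [session]
    constructor
    · intro o ho
      rw [PMF.mem_support_bind_iff] at ho
      obtain ⟨o', ho', ho⟩ := ho
      obtain ⟨s, h, rfl, hs⟩ := ih.1 o' ho'
      exact (hserve s h hs).1 o ho
    · rw [expect_bind]
      refine le_trans (expect_mono ?_) ih.2
      intro o' ho'
      obtain ⟨s, h, rfl, hs⟩ := ih.1 o' ho'
      exact (hserve s h hs).2

/-- Markov's inequality, for the complement of `G`. -/
theorem one_sub_le_toOuterMeasure {α : Type*} (p : PMF α) (G : Set α) {f : α → ℝ≥0∞} {δ : ℝ}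
    (hδ : 0 ≤ δ) (hf : ∀ a ∈ p.support, a ∉ G → 1 ≤ f a) (h : expect p f ≤ ENNReal.ofReal δ) :
    ENNReal.ofReal (1 - δ) ≤ p.toOuterMeasure G := by
  rw [ENNReal.ofReal_sub _ hδ, ENNReal.ofReal_one, tsub_le_iff_right]
  refine le_trans ?_ (add_le_add_right h _)
  have : p.toOuterMeasure G = expect p (G.indicator fun _ => 1) := by
    rw [PMF.toOuterMeasure_apply, expect]
    refine tsum_congr fun a => ?_
    by_cases ha : a ∈ G <;> simp [ha]
  rw [this, ← expect_add]
  refine (expect_const p 1).symm.le.trans (expect_mono fun a ha => ?_)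
  by_cases hG : a ∈ G
  · simp [hG]
  · simpa [hG] using hf a ha hG

end OnlineMatching

open OnlineMatching in
theorem theorem4p3 :
    ∃ (P : DataStructure) (C k : ℕ),
      ∀ (n d : ℕ) (ε δ D : ℝ) (x : Fin n → EuclideanSpace ℝ (Fin d)),
        0 < n → 0 < d → 0 < ε → ε < 1 → 0 < δ → δ < 1 → 0 < D → (∀ i, ‖x i‖ ≤ D) →
      ∀ B : Budget,
        B.init =
          ⌊softO C k (max 1 (ε⁻¹ ^ 2 * D ^ 2) * (n * d) * (1 + Real.log (n / δ)))⌋₊ →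
        (∀ t : ℕ, B.update t =
          ⌊softO C k (max 1 (ε⁻¹ ^ 2 * D ^ 2) * (n + d) *
            (1 + Real.log (max (n : ℝ) t / δ)))⌋₊) →
        B.query = C →
      ∀ A : Adversary n d, (∀ h y, A h = Request.update y → ‖y‖ ≤ 1) →
      ∀ r : ℕ,
        (∀ o ∈ (session P B x ε δ A r).support,
          ∃ (s : State) (h : History n d), o = some (s, h) ∧
            (s.touched.card : ℝ) ≤
              softO C k (max 1 (ε⁻¹ ^ 2 * D ^ 2) * (n * d) * (1 + Real.log (n / δ))) ∧
            ∀ (a : ℝ) (h' : History n d),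
              (Event.answered a :: h') <:+ h → a = History.alg x h') ∧
        ENNReal.ofReal (1 - δ) ≤
          (session P B x ε δ A r).toOuterMeasure
            {o | ∃ (s : State) (h : History n d), o = some (s, h) ∧
              ∀ h' : History n d, h' <:+ h →
                History.alg x h' ≥
                  (1 / 2) * History.opt x h' - (3 / 2) * (History.numOnline h' : ℝ) * ε} := by
  -- The running times need no logarithmic factors beyond those in the statement, so the exponent of
  -- the soft-O bound can be zero.
  refine ⟨greedyStructure, 7500, 0, ?_⟩
  intro n d ε δ D x hn hd hε hε1 hδ hδ1 hD hx B hBi hBu hBq A hA r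
  set κ : ℝ := max 1 (ε⁻¹ ^ 2 * D ^ 2) with hκdef
  have hκ : 1 ≤ κ := le_max_left _ _
  have hn1 : (1 : ℝ) ≤ n := by exact_mod_cast hn
  have hd1 : (1 : ℝ) ≤ d := by exact_mod_cast hd
  have hnd1 : (1 : ℝ) ≤ n * d := one_le_mul_of_one_le_of_one_le hn1 hd1
  have hlog : ∀ M : ℝ, 1 ≤ M → 1 ≤ 1 + Real.log (M / δ) := by
    intro M hM
    have : 1 ≤ M / δ := by
      rw [le_div_iff₀ hδ]
      linarith
    linarith [Real.log_nonneg this]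
  have hspace : (150 * (n * d) : ℝ) ≤ softO 7500 0 (κ * (n * d) * (1 + Real.log (n / δ))) := by
    have h1 : (1 : ℝ) * (n * d) * 1 ≤ κ * (n * d) * (1 + Real.log (n / δ)) := by
      have := hlog n hn1
      gcongr
    simp only [softO, pow_zero, mul_one, Nat.cast_ofNat]
    linarith
  have hinit : 150 * (n * d) ≤ B.init := by
    rw [hBi]
    refine Nat.le_floor ?_
    push_cast
    exact hspace
  have hupdate : ∀ t m : ℕ, 0 < t → (m : ℝ) ≤ 48 * κ * (1 + Real.log (max (n : ℝ) t / δ)) + 1 →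
      150 * (n + d) * (m + 1) ≤ B.update t := by
    intro t m _ hm
    rw [hBu]
    refine Nat.le_floor ?_
    have hl := hlog (max (n : ℝ) t) (hn1.trans (le_max_left _ _))
    set L := 1 + Real.log (max (n : ℝ) t / δ) with hL
    have hκL : 1 ≤ κ * L := one_le_mul_of_one_le_of_one_le hκ hl
    have h1 : (m : ℝ) + 1 ≤ 50 * (κ * L) := by linarith
    simp only [softO, pow_zero, mul_one]
    push_cast
    calc (150 * (n + d) * (m + 1) : ℝ) ≤ 150 * (n + d) * (50 * (κ * L)) := by gcongr
      _ = 7500 * (κ * (n + d) * L) := by ring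
  obtain ⟨hsupp, hexp⟩ := session_spec (B := B) (A := A) (x := x) (ε := ε) (δ := δ) hκ
    ((ends_initProg x hn hd hε hδ hδ1 hx).conseq hinit fun _ h => h) hupdate (by rw [hBq]; norm_num)
    hA r
  refine ⟨fun o ho => ?_, ?_⟩
  · obtain ⟨s, h, rfl, ⟨p, ⟨rfl, rfl, -, -, -, -⟩, hmem⟩, hans⟩ := hsupp o ho
    refine ⟨s, h, rfl, ?_, hans⟩
    have h1 : (s.touched.card : ℝ) ≤ 7 * (p.n * p.d) := by
      exact_mod_cast hmem.within.card_le hn hd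
    linarith
  · refine one_sub_le_toOuterMeasure _ _ hδ.le (fun o ho hbad => ?_) hexp
    obtain ⟨s, h, rfl, -⟩ := hsupp o ho
    have hng : ¬ Greedy x ε (arrivals h) := by
      intro hg
      refine hbad ⟨s, h, rfl, ?_⟩
      rintro h' ⟨l, rfl⟩
      refine Greedy.half_opt_le hε.le hn ?_
      rw [arrivals, List.filterMap_append] at hg
      exact hg.of_append
    simp [failurePotential, hng]
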